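/- Let $\alpha,\beta>-1$ and $M,N\ge 0$. For $a,b>-1$ let $p_n^{(a,b)}$ $(n\ge 0)$ denote the Jacobi orthonormal polynomials, i.e. the polynomials of degree $n$ with positive leading coefficient that are orthonormal with respect to $\int_{-1}^{1} fg\,(1-x)^{a}(1+x)^{b}\,dx$, and let $q_n$ $(n\ge 0)$ denote the polynomials of degree $n$ with positive leading coefficient that are orthonormal with respect to the inner product $$\langle f,g\rangle=\int_{-1}^{1} fg\,(1-x)^{\alpha}(1+x)^{\beta}\,dx+M f(1)g(1)+N f'(1)g'(1).$$ For sequences write $z_n\cong w_n$ if $z_n/w_n\to 1$ as $n\to\infty$. For every $n\ge 2$ there are unique real numbers $A_n,B_n,C_n$ such that $$q_n(x)=A_n\,p_n^{(\alpha,\beta)}(x)+B_n\,(x-1)\,p_{n-1}^{(\alpha+2,\beta)}(x)+C_n\,(x-1)^2\,p_{n-2}^{(\alpha+4,\beta)}(x),$$ and they satisfy: a) if $MN>0$, then there are constants $c_1,c_2>0$, independent of $n$, such that $$A_n\cong -c_1\,n^{-2\alpha-2},\qquad B_n\cong c_2\,n^{-2\alpha-2},\qquad C_n\cong 1;$$ b)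 if $M=0$ and $N>0$, then $$A_n\cong -\frac{1}{\alpha+2},\qquad B_n\cong 1,\qquad C_n\cong \frac{1}{\alpha+2}.$$ -/

import Mathlib

open Polynomial Filter Topology

/-- The Jacobi weight `w_{a,b}(x) = (1 - x)^a (1 + x)^b` on `(-1, 1)`. -/
noncomputable def jacobiWeight (a b x : ℝ) : ℝ := (1 - x) ^ a * (1 + x) ^ b

/-- The inner product of `L²([-1,1], w_{a,b})`, on real polynomials. -/
noncomputable def jacobiInner (a b : ℝ) (f g : ℝ[X]) : ℝ :=
  ∫ x in (-1 : ℝ)..1, f.eval x * g.eval x * jacobiWeight a b x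

/-- The Sobolev-type inner product
`⟨f, g⟩ = ∫_{[-1,1]} f g w_{a,b} dx + M f(1) g(1) + N f'(1) g'(1)`. -/
noncomputable def jacobiSobolevInner (a b M N : ℝ) (f g : ℝ[X]) : ℝ :=
  jacobiInner a b f g + M * (f.eval 1 * g.eval 1)
    + N * ((derivative f).eval 1 * (derivative g).eval 1)

/-- The monic orthogonal polynomials of a form `B` on `ℝ[X]`: the Gram–Schmidt process
applied to `1, X, X², …`. -/
noncomputable def monicOrthPoly (B : ℝ[X] → ℝ[X] → ℝ) (n : ℕ) : ℝ[X] :=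
  X ^ n - ∑ k : Fin n,
    C (B (X ^ n) (monicOrthPoly B k) / B (monicOrthPoly B k) (monicOrthPoly B k))
      * monicOrthPoly B k
termination_by n
decreasing_by all_goals exact k.2

/-- The orthonormal polynomials of a form `B` on `ℝ[X]`, with positive leading coefficients. -/
noncomputable def orthonormalPoly (B : ℝ[X] → ℝ[X] → ℝ) (n : ℕ) : ℝ[X] :=
  C (Real.sqrt (B (monicOrthPoly B n) (monicOrthPoly B n)))⁻¹ * monicOrthPoly B n

/-- The orthonormal Jacobi polynomials `p_n^{(a,b)}`. -/
noncomputable def jacobiOrthonormal (a b : ℝ) (n : ℕ) : ℝ[X] :=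
  orthonormalPoly (jacobiInner a b) n

/-- The orthonormal Jacobi–Sobolev type polynomials `q_n^{(a,b)}`. -/
noncomputable def jacobiSobolevOrthonormal (a b M N : ℝ) (n : ℕ) : ℝ[X] :=
  orthonormalPoly (jacobiSobolevInner a b M N) n

/-- `z_n ≅ w_n`: the sequence `z_n / w_n` converges to `1`. -/
def AsympEq (z w : ℕ → ℝ) : Prop := Tendsto (fun n => z n / w n) atTop (𝓝 1)

/-! The Gram–Schmidt construction yields what it should. -/

theorem jacobi_integrable {a b : ℝ} (ha : -1 < a) (hb : -1 < b) (r : ℝ[X]) :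
    IntervalIntegrable (fun x => r.eval x * jacobiWeight a b x) MeasureTheory.volume (-1) 1 := by
  have h1 : IntervalIntegrable (fun x => r.eval x * jacobiWeight a b x)
      MeasureTheory.volume (-1) 0 := by
    have h : IntervalIntegrable (fun x : ℝ => (1 + x) ^ b) MeasureTheory.volume (-1) 0 := by
      have := (intervalIntegral.intervalIntegrable_rpow' (a := 0) (b := 1) hb).comp_add_left 1
      simpa using this
    have hc : ContinuousOn (fun x : ℝ => r.eval x * (1 - x) ^ a) (Set.uIcc (-1) 0) := by
      refine r.continuous.continuousOn.mul (ContinuousOn.rpow_const (by fun_prop) ?_)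
      intro x hx
      rw [Set.uIcc_of_le (by norm_num)] at hx
      left; linarith [hx.2]
    refine (h.continuousOn_mul hc).congr ?_
    intro x _
    simp only [jacobiWeight]; ring
  have h2 : IntervalIntegrable (fun x => r.eval x * jacobiWeight a b x)
      MeasureTheory.volume 0 1 := by
    have h : IntervalIntegrable (fun x : ℝ => (1 - x) ^ a) MeasureTheory.volume 0 1 := by
      have := (intervalIntegral.intervalIntegrable_rpow' (a := 1) (b := 0) ha).comp_sub_left 1
      simpa using this
    have hc : ContinuousOn (fun x : ℝ => r.eval x * (1 + x) ^ b) (Set.uIcc 0 1) := by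
      refine r.continuous.continuousOn.mul (ContinuousOn.rpow_const (by fun_prop) ?_)
      intro x hx
      rw [Set.uIcc_of_le (by norm_num)] at hx
      left; linarith [hx.1]
    refine (h.continuousOn_mul hc).congr ?_
    intro x _
    simp only [jacobiWeight]; ring
  exact h1.trans h2

theorem jacobiInner_self_pos {a b : ℝ} (ha : -1 < a) (hb : -1 < b) {f : ℝ[X]} (hf : f ≠ 0) :
    0 < jacobiInner a b f f := by
  have hi := jacobi_integrable ha hb (f * f)
  simp only [eval_mul] at hi
  have hw : ∀ x ∈ Set.Ioo (-1 : ℝ) 1, 0 < jacobiWeight a b x := fun x hx =>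
    mul_pos (Real.rpow_pos_of_pos (by linarith [hx.2]) _)
      (Real.rpow_pos_of_pos (by linarith [hx.1]) _)
  have hn : 0 ≤ᵐ[MeasureTheory.volume.restrict (Set.uIoc (-1 : ℝ) 1)]
      fun x => f.eval x * f.eval x * jacobiWeight a b x := by
    rw [Set.uIoc_of_le (by norm_num), ← MeasureTheory.restrict_Ioo_eq_restrict_Ioc]
    exact (MeasureTheory.ae_restrict_iff' measurableSet_Ioo).2 (Filter.Eventually.of_forall
      fun x hx => mul_nonneg (mul_self_nonneg _) (hw x hx).le)
  refine (intervalIntegral.integral_pos_iff_support_of_nonneg_ae' hn hi).2 ⟨by norm_num, ?_⟩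
  have hsub : Set.Ioo (-1 : ℝ) 1 \ (f.roots.toFinset : Set ℝ) ⊆
      Function.support (fun x => f.eval x * f.eval x * jacobiWeight a b x) ∩ Set.Ioc (-1) 1 := by
    rintro x ⟨hx, hr⟩
    have h0 : f.eval x ≠ 0 := by
      intro h
      exact hr (by simp [hf, h])
    exact ⟨mul_ne_zero (mul_ne_zero h0 h0) (hw x hx).ne', hx.1, hx.2.le⟩
  refine lt_of_lt_of_le ?_ (MeasureTheory.measure_mono hsub)
  rw [MeasureTheory.measure_sdiff_null (Finset.measure_zero _ _)]
  simp

/-- `B` is a real inner product on `ℝ[X]`. -/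
structure IsPolyInner (B : ℝ[X] → ℝ[X] → ℝ) : Prop where
  add_left : ∀ f g h, B (f + g) h = B f h + B g h
  smul_left : ∀ (c : ℝ) f h, B (C c * f) h = c * B f h
  symm : ∀ f g, B f g = B g f
  pos : ∀ f, f ≠ 0 → 0 < B f f

theorem isPolyInner_jacobiInner {a b : ℝ} (ha : -1 < a) (hb : -1 < b) :
    IsPolyInner (jacobiInner a b) where
  add_left f g h := by
    have h1 := jacobi_integrable ha hb (f * h)
    have h2 := jacobi_integrable ha hb (g * h)
    simp only [eval_mul] at h1 h2
    simp only [jacobiInner, eval_add, add_mul]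
    exact intervalIntegral.integral_add h1 h2
  smul_left c f h := by
    simp only [jacobiInner, eval_mul, eval_C, mul_assoc]
    exact intervalIntegral.integral_const_mul _ _
  symm f g := by
    simp only [jacobiInner, mul_comm (f.eval _)]
  pos f hf := jacobiInner_self_pos ha hb hf

theorem isPolyInner_jacobiSobolevInner {a b M N : ℝ} (ha : -1 < a) (hb : -1 < b)
    (hM : 0 ≤ M) (hN : 0 ≤ N) : IsPolyInner (jacobiSobolevInner a b M N) where
  add_left f g h := by
    simp only [jacobiSobolevInner, (isPolyInner_jacobiInner ha hb).add_left, eval_add,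
      derivative_add]
    ring
  smul_left c f h := by
    simp only [jacobiSobolevInner, (isPolyInner_jacobiInner ha hb).smul_left, eval_mul, eval_C,
      derivative_C_mul]
    ring
  symm f g := by
    simp only [jacobiSobolevInner, (isPolyInner_jacobiInner ha hb).symm f g]
    ring
  pos f hf := by
    have := jacobiInner_self_pos ha hb hf
    have := mul_nonneg hM (mul_self_nonneg (f.eval 1))
    have := mul_nonneg hN (mul_self_nonneg ((derivative f).eval 1))
    simp only [jacobiSobolevInner]
    linarith

theorem monicOrthPoly_monic (B : ℝ[X] → ℝ[X] → ℝ) (n : ℕ) :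
    (monicOrthPoly B n).Monic ∧ (monicOrthPoly B n).natDegree = n := by
  induction n using Nat.strong_induction_on with
  | _ n ih =>
    have hd : (∑ k : Fin n,
        C (B (X ^ n) (monicOrthPoly B k) / B (monicOrthPoly B k) (monicOrthPoly B k))
          * monicOrthPoly B k).degree < (n : WithBot ℕ) := by
      refine (degree_sum_le _ _).trans_lt ((Finset.sup_lt_iff (WithBot.bot_lt_coe n)).2 ?_)
      intro k _
      refine degree_le_natDegree.trans_lt ?_
      refine lt_of_le_of_lt (WithBot.coe_le_coe.2 (natDegree_C_mul_le _ _)) ?_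
      rw [(ih k k.2).2]
      exact WithBot.coe_lt_coe.2 k.2
    rw [monicOrthPoly]
    refine ⟨monic_X_pow_sub hd, ?_⟩
    refine natDegree_eq_of_degree_eq_some ?_
    rw [degree_sub_eq_left_of_degree_lt (by rwa [degree_X_pow]), degree_X_pow]

theorem monicOrthPoly_orth {B : ℝ[X] → ℝ[X] → ℝ} (hB : IsPolyInner B) (n : ℕ) :
    ∀ m < n, B (monicOrthPoly B n) (monicOrthPoly B m) = 0 := by
  induction n using Nat.strong_induction_on with
  | _ n ih =>
    intro m hm
    let L : ℝ[X] →+ ℝ :=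
      AddMonoidHom.mk' (fun f => B f (monicOrthPoly B m)) fun f g => hB.add_left f g _
    have hne := (hB.pos _ (monicOrthPoly_monic B m).1.ne_zero).ne'
    have hL : L (monicOrthPoly B n) = 0 := by
      rw [monicOrthPoly, map_sub, map_sum, Finset.sum_eq_single (⟨m, hm⟩ : Fin n)]
      · simp only [L, AddMonoidHom.mk'_apply, hB.smul_left]
        field_simp
        simp
      · intro k _ hk
        have hkm : (k : ℕ) ≠ m := fun h => hk (Fin.ext h)
        simp only [L, AddMonoidHom.mk'_apply, hB.smul_left]
        rcases lt_or_gt_of_ne hkm with h | h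
        · rw [hB.symm (monicOrthPoly B k) (monicOrthPoly B m), ih m hm k h, mul_zero]
        · rw [ih k k.2 m h, mul_zero]
      · simp
    exact hL

/-- For an inner product `B`, the polynomials `orthonormalPoly B n` are orthonormal, of degree
`n`, with positive leading coefficient. -/
theorem orthonormalPoly_spec {B : ℝ[X] → ℝ[X] → ℝ} (hB : IsPolyInner B) :
    (∀ m n, B (orthonormalPoly B m) (orthonormalPoly B n) = if m = n then 1 else 0) ∧
      ∀ n, (orthonormalPoly B n).natDegree = n ∧ 0 < (orthonormalPoly B n).leadingCoeff := by
  have hp : ∀ n, 0 < B (monicOrthPoly B n) (monicOrthPoly B n) := fun n =>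
    hB.pos _ (monicOrthPoly_monic B n).1.ne_zero
  refine ⟨fun m n => ?_, fun n => ?_⟩
  · rw [orthonormalPoly, orthonormalPoly, hB.smul_left,
      hB.symm (monicOrthPoly B m) (C _ * _), hB.smul_left]
    split_ifs with h
    · subst h
      have h2 := Real.mul_self_sqrt (hp m).le
      have h3 := (Real.sqrt_pos.2 (hp m)).ne'
      field_simp
      rw [sq, h2]
    · rcases lt_or_gt_of_ne h with h | h
      · rw [monicOrthPoly_orth hB n m h, mul_zero, mul_zero]
      · rw [hB.symm (monicOrthPoly B n) (monicOrthPoly B m), monicOrthPoly_orth hB m n h, mul_zero, mul_zero]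
  · have h3 := inv_pos.2 (Real.sqrt_pos.2 (hp n))
    rw [orthonormalPoly, natDegree_C_mul h3.ne', leadingCoeff_mul, leadingCoeff_C,
      (monicOrthPoly_monic B n).1.leadingCoeff, mul_one]
    exact ⟨(monicOrthPoly_monic B n).2, h3⟩

/-! Polynomials divisible by `(X - 1) ^ 2` do not see the masses at 1. Hence `q_n` is orthogonal for
the Jacobi weight to `(X - 1) ^ 2` times every polynomial of degree below `n - 2`. Removing from
`q_n` its value at 1 with `p_n^(α,β)`, and then the value at 1 of the quotient by `X - 1` with
`p_{n-1}^(α+2,β)`, leaves `(X - 1) ^ 2 * e`. This orthogonality passes to `e` for the weight with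
parameter `α + 4`, so `e` is a multiple of `p_{n-2}^(α+4,β)` (`exists_jacobi_expansion`).

The three coefficients satisfy three equations (`jacobiSobolev_relations`): orthogonality of `q_n`
to `1` and to `X - 1`, which is linear and fixes `A / C` and `B / C`, and a normalization, which
then fixes `C`. Their data are values at 1, leading coefficients and a few moments of Jacobi
polynomials.

All these data come from one observation (`exists_momentNumerator_eq`): the integral of `p_n^(a,b)`
against `(1-x)^s (1+x)^b` is a Gamma factor times a polynomial in `s` of degree at most `n`, and
orthogonality makes it vanish at `a, ..., a + n - 1`. This determines it up to a constant; its
values at well-chosen `s` give the value and derivative at 1, the leading coefficient, the norm and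
the moments.

With `t = α + 2`, `A / B` tends to `-1 / t` in both cases. For `M = 0` the first equation gives `B /
C → t`, so the normalization gives `C → 1 / (-1 + t + 1)`. For `M > 0` the mass term, of relative
size `n ^ (2α+2)`, forces `A` and `B` down to order `n ^ (-2α-2)`, and `C → 1`
(`tendsto_coefficients`). -/

/-! ### Inner products on polynomials -/

namespace IsPolyInner

variable {B : ℝ[X] → ℝ[X] → ℝ}

theorem add_right (hB : IsPolyInner B) (f g h : ℝ[X]) : B f (g + h) = B f g + B f h := by
  rw [hB.symm, hB.add_left, hB.symm g, hB.symm h]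

theorem smul_right (hB : IsPolyInner B) (c : ℝ) (f g : ℝ[X]) : B f (C c * g) = c * B f g := by
  rw [hB.symm, hB.smul_left, hB.symm g]

theorem zero_right (hB : IsPolyInner B) (f : ℝ[X]) : B f 0 = 0 := by
  simpa using hB.smul_right 0 f 0

theorem coeff_pos (hB : IsPolyInner B) (n : ℕ) : 0 < (orthonormalPoly B n).coeff n := by
  have h := (orthonormalPoly_spec hB).2 n
  have := h.2
  rwa [leadingCoeff, h.1] at this

theorem degree_sub_lt (hB : IsPolyInner B) {n : ℕ} {f : ℝ[X]} (hf : f.natDegree ≤ n) :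
    (f - C (f.coeff n / (orthonormalPoly B n).coeff n) * orthonormalPoly B n).degree < n := by
  have hp := hB.coeff_pos n
  rw [degree_lt_iff_coeff_zero]
  intro k hk
  rcases hk.eq_or_lt with rfl | hk
  · simp only [coeff_sub, coeff_C_mul]
    field_simp
    simp
  · have h1 : (orthonormalPoly B n).coeff k = 0 := by
      apply coeff_eq_zero_of_natDegree_lt
      rwa [((orthonormalPoly_spec hB).2 n).1]
    have h2 : f.coeff k = 0 := coeff_eq_zero_of_natDegree_lt (by omega)
    simp [h1, h2]

theorem inner_of_degree_lt (hB : IsPolyInner B) (n : ℕ) {f : ℝ[X]} (hf : f.degree < n) :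
    B (orthonormalPoly B n) f = 0 := by
  suffices H : ∀ m ≤ n, ∀ f : ℝ[X], f.degree < m → B (orthonormalPoly B n) f = 0 from
    H n le_rfl f hf
  intro m
  induction m with
  | zero =>
    intro _ f hf
    have : f = 0 := by
      rw [← degree_eq_bot]
      exact Nat.WithBot.lt_zero_iff.1 (by simpa using hf)
    rw [this, hB.zero_right]
  | succ m ih =>
    intro hm f hf
    set p := orthonormalPoly B m
    have hd : (f - C (f.coeff m / p.coeff m) * p).degree < m :=
      hB.degree_sub_lt <| natDegree_le_iff_coeff_eq_zero.2 fun k hk =>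
        (degree_lt_iff_coeff_zero _ _).1 hf k hk
    have h1 := ih (by omega) _ hd
    have h2 : B (orthonormalPoly B n) p = 0 := by
      rw [(orthonormalPoly_spec hB).1, if_neg (by omega)]
    have h3 := hB.add_right (orthonormalPoly B n) (f - C (f.coeff m / p.coeff m) * p)
      (C (f.coeff m / p.coeff m) * p)
    rw [h1, hB.smul_right, h2, sub_add_cancel] at h3
    simpa using h3

/-- Only the top-degree part of `f` is seen by the `n`-th orthonormal polynomial. This turns the
norm conditions below into quotients of leading coefficients. -/
theorem inner_of_natDegree_le (hB : IsPolyInner B) {n : ℕ} {f : ℝ[X]} (hf : f.natDegree ≤ n) :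
    B (orthonormalPoly B n) f = f.coeff n / (orthonormalPoly B n).coeff n := by
  have h := hB.inner_of_degree_lt n (hB.degree_sub_lt hf)
  have h3 := hB.add_right (orthonormalPoly B n)
    (f - C (f.coeff n / (orthonormalPoly B n).coeff n) * orthonormalPoly B n)
    (C (f.coeff n / (orthonormalPoly B n).coeff n) * orthonormalPoly B n)
  rw [h, hB.smul_right, (orthonormalPoly_spec hB).1, if_pos rfl, sub_add_cancel] at h3
  simpa using h3

/-- A polynomial of degree at most `n` that is orthogonal to all polynomials of degree less
than `n` is a multiple of the `n`-th orthonormal polynomial. -/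
theorem eq_smul_of_orthogonal (hB : IsPolyInner B) {n : ℕ} {f : ℝ[X]} (hf : f.natDegree ≤ n)
    (h : ∀ g : ℝ[X], g.degree < n → B f g = 0) :
    ∃ c : ℝ, f = C c * orthonormalPoly B n := by
  refine ⟨f.coeff n / (orthonormalPoly B n).coeff n, ?_⟩
  set c := f.coeff n / (orthonormalPoly B n).coeff n
  have hd := hB.degree_sub_lt hf
  have h1 := h _ hd
  have h2 := hB.inner_of_degree_lt n hd
  have h3 := hB.add_left (f - C c * orthonormalPoly B n) (C c * orthonormalPoly B n)
    (f - C c * orthonormalPoly B n)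
  rw [hB.smul_left, h2, sub_add_cancel, h1] at h3
  by_contra hne
  have := hB.pos (f - C c * orthonormalPoly B n) (sub_ne_zero.2 hne)
  linarith

end IsPolyInner

/-! ### Moments of the Jacobi weight -/

/-- The moment functional of the Jacobi weight. -/
noncomputable def jacobiMoment (a b : ℝ) (f : ℝ[X]) : ℝ := jacobiInner a b f 1

theorem jacobiInner_eq_moment (a b : ℝ) (f g : ℝ[X]) :
    jacobiInner a b f g = jacobiMoment a b (f * g) := by
  simp [jacobiMoment, jacobiInner]

theorem jacobiMoment_add {a b : ℝ} (ha : -1 < a) (hb : -1 < b) (f g : ℝ[X]) :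
    jacobiMoment a b (f + g) = jacobiMoment a b f + jacobiMoment a b g :=
  (isPolyInner_jacobiInner ha hb).add_left f g 1

theorem jacobiMoment_smul {a b : ℝ} (ha : -1 < a) (hb : -1 < b) (c : ℝ) (f : ℝ[X]) :
    jacobiMoment a b (C c * f) = c * jacobiMoment a b f :=
  (isPolyInner_jacobiInner ha hb).smul_left c f 1

theorem jacobiMoment_sum {a b : ℝ} (ha : -1 < a) (hb : -1 < b) {ι : Type*} (s : Finset ι)
    (f : ι → ℝ[X]) :
    jacobiMoment a b (∑ i ∈ s, f i) = ∑ i ∈ s, jacobiMoment a b (f i) :=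
  map_sum (AddMonoidHom.mk' (jacobiMoment a b) (jacobiMoment_add ha hb)) f s

theorem jacobiMoment_one_sub_X_mul (a b : ℝ) (f : ℝ[X]) :
    jacobiMoment a b ((1 - X) * f) = jacobiMoment (a + 1) b f := by
  refine intervalIntegral.integral_congr_Ioo_of_le (by norm_num) fun x hx => ?_
  have : 0 < 1 - x := by linarith [hx.2]
  simp only [jacobiWeight, Real.rpow_add_one this.ne', eval_mul, eval_sub, eval_one, eval_X]
  ring

theorem jacobiMoment_X_sub_one_mul {a b : ℝ} (ha : -1 < a) (hb : -1 < b) (f : ℝ[X]) :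
    jacobiMoment a b ((X - 1) * f) = -jacobiMoment (a + 1) b f := by
  rw [← jacobiMoment_one_sub_X_mul, show (X - 1) * f = C (-1) * ((1 - X) * f) by
    simp; ring, jacobiMoment_smul ha hb]
  ring

theorem jacobiMoment_one_sub_X_pow_mul (a b : ℝ) (k : ℕ) (f : ℝ[X]) :
    jacobiMoment a b ((1 - X) ^ k * f) = jacobiMoment (a + k) b f := by
  induction k generalizing a with
  | zero => simp
  | succ k ih =>
    rw [pow_succ', mul_assoc, jacobiMoment_one_sub_X_mul, ih]
    push_cast
    ring_nf

theorem jacobiMoment_X_sub_one_sq_mul (a b : ℝ) (f : ℝ[X]) :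
    jacobiMoment a b ((X - 1) ^ 2 * f) = jacobiMoment (a + 2) b f := by
  have := jacobiMoment_one_sub_X_pow_mul a b 2 f
  rw [show (X - 1 : ℝ[X]) ^ 2 = (1 - X) ^ 2 by ring, this]
  norm_num

/-- The substitution `x = 2 t - 1` reduces this to Euler's beta integral. -/
theorem jacobiMoment_one {a b : ℝ} (ha : -1 < a) (hb : -1 < b) :
    jacobiMoment a b 1 = 2 ^ (a + b + 1) * Real.Gamma (a + 1) * Real.Gamma (b + 1)
      / Real.Gamma (a + b + 2) := by
  have hB := ProbabilityTheory.beta_eq_betaIntegralReal (b + 1) (a + 1) (by linarith) (by linarith)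
  have hre : (Complex.betaIntegral (b + 1 : ℝ) (a + 1 : ℝ)).re
      = ∫ x in (0 : ℝ)..1, x ^ b * (1 - x) ^ a := by
    rw [Complex.betaIntegral, ← Complex.ofReal_re (∫ x in (0 : ℝ)..1, x ^ b * (1 - x) ^ a),
      ← intervalIntegral.integral_ofReal]
    congr 1
    refine intervalIntegral.integral_congr_Ioo_of_le (by norm_num) fun x hx => ?_
    simp only [Complex.ofReal_mul]
    rw [Complex.ofReal_cpow hx.1.le, Complex.ofReal_cpow (by linarith [hx.2])]
    push_cast
    ring_nf
  have hsub : jacobiMoment a b 1 = ∫ x in (-1 : ℝ)..1, (1 + x) ^ b * (1 - x) ^ a := by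
    simp only [jacobiMoment, jacobiInner, jacobiWeight, eval_one, one_mul]
    simp only [mul_comm]
  have hscale := intervalIntegral.smul_integral_comp_mul_sub (a := 0) (b := 1)
    (fun x : ℝ => (1 + x) ^ b * (1 - x) ^ a) 2 1
  have hcongr : (∫ x in (0 : ℝ)..1, (1 + (2 * x - 1)) ^ b * (1 - (2 * x - 1)) ^ a)
      = 2 ^ (a + b) * ∫ x in (0 : ℝ)..1, x ^ b * (1 - x) ^ a := by
    rw [← intervalIntegral.integral_const_mul]
    refine intervalIntegral.integral_congr_Ioo_of_le (by norm_num) fun x hx => ?_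
    have h1 : 0 ≤ x := hx.1.le
    have h2 : 0 ≤ 1 - x := by linarith [hx.2]
    rw [show 1 + (2 * x - 1) = 2 * x by ring, show 1 - (2 * x - 1) = 2 * (1 - x) by ring,
      Real.mul_rpow (by norm_num) h1, Real.mul_rpow (by norm_num) h2,
      Real.rpow_add (by norm_num)]
    ring
  norm_num at hscale
  norm_num at hcongr
  rw [hsub, ← hscale, hcongr, ← hre, ← hB, ProbabilityTheory.beta,
    Real.rpow_add_one (by norm_num), show b + 1 + (a + 1) = a + b + 2 by ring]
  ring

theorem Real.Gamma_add_natCast {x : ℝ} (hx : 0 < x) (n : ℕ) :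
    Real.Gamma (x + n) = Real.Gamma x * ∏ j ∈ Finset.range n, (x + j) := by
  induction n with
  | zero => simp
  | succ n ih =>
    rw [Finset.prod_range_succ, Nat.cast_succ, ← add_assoc, Real.Gamma_add_one (by positivity), ih]
    ring

/-! ### Jacobi polynomials: moments and special values -/

theorem eq_sum_one_sub_X_pow {f : ℝ[X]} {n : ℕ} (hf : f.natDegree ≤ n) :
    f = ∑ k ∈ Finset.range (n + 1), C ((f.comp (1 - X)).coeff k) * (1 - X) ^ k := by
  have hd : (f.comp (1 - X)).natDegree < n + 1 := by
    have h1 : (1 - X : ℝ[X]).natDegree ≤ 1 := by compute_degree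
    have h2 := natDegree_comp_le (p := f) (q := 1 - X)
    nlinarith
  have h := (f.comp (1 - X)).as_sum_range_C_mul_X_pow' hd
  have h2 : f = (f.comp (1 - X)).comp (1 - X) := by
    rw [comp_assoc]; simp
  conv_lhs => rw [h2, h]
  simp [sum_comp]

/-- The numerator of the rational function `s ↦ jacobiMoment s b f / jacobiMoment s b 1`. -/
noncomputable def momentNumerator (b : ℝ) (n : ℕ) (f : ℝ[X]) (s : ℝ) : ℝ :=
  ∑ k ∈ Finset.range (n + 1), (f.comp (1 - X)).coeff k * 2 ^ k *
    (∏ j ∈ Finset.range k, (s + 1 + j)) * ∏ j ∈ Finset.Ico k n, (s + b + 2 + j)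

/-- Each power `(1 - X) ^ k` contributes a beta integral; the sum is put over the common denominator
`Γ(s + b + 2 + n)`. -/
theorem jacobiMoment_eq_numerator {b s : ℝ} (hb : -1 < b) (hs : -1 < s) {f : ℝ[X]} {n : ℕ}
    (hf : f.natDegree ≤ n) :
    jacobiMoment s b f = 2 ^ (s + b + 1) * Real.Gamma (s + 1) * Real.Gamma (b + 1)
      / Real.Gamma (s + b + 2 + n) * momentNumerator b n f s := by
  conv_lhs => rw [eq_sum_one_sub_X_pow hf]
  rw [jacobiMoment_sum hs hb, momentNumerator, Finset.mul_sum]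
  refine Finset.sum_congr rfl fun k hk => ?_
  have hk' : k ≤ n := by simpa [Nat.lt_succ_iff] using hk
  have hsk : -1 < s + k := by linarith [(Nat.cast_nonneg k : (0 : ℝ) ≤ k)]
  have h1 : jacobiMoment s b ((1 - X) ^ k) = jacobiMoment (s + k) b 1 := by
    simpa using jacobiMoment_one_sub_X_pow_mul s b k 1
  have h2 := Real.Gamma_add_natCast (x := s + 1) (by linarith) k
  have h3 := Real.Gamma_add_natCast (x := s + b + 2) (by linarith) k
  have h4 := Real.Gamma_add_natCast (x := s + b + 2) (by linarith) n
  rw [← Finset.prod_range_mul_prod_Ico _ hk'] at h4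
  have hp1 : ∏ j ∈ Finset.range k, (s + b + 2 + (j : ℝ)) ≠ 0 :=
    (Finset.prod_pos fun j _ => by have := Nat.cast_nonneg (α := ℝ) j; linarith).ne'
  have hp2 : ∏ j ∈ Finset.Ico k n, (s + b + 2 + (j : ℝ)) ≠ 0 :=
    (Finset.prod_pos fun j _ => by have := Nat.cast_nonneg (α := ℝ) j; linarith).ne'
  have hG : Real.Gamma (s + b + 2) ≠ 0 := (Real.Gamma_pos_of_pos (by linarith)).ne'
  rw [jacobiMoment_smul hs hb, h1, jacobiMoment_one hsk hb,
    show s + k + b + 1 = s + b + 1 + k by ring, show (s + k + 1 : ℝ) = s + 1 + k by ring,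
    show s + k + b + 2 = s + b + 2 + k by ring, h2, h3, h4, Real.rpow_add_natCast (by norm_num)]
  field_simp

/-- For `j < n` the moment at `s = a + j` is the inner product of `p_n` with `(1 - X) ^ j`, hence
zero. A polynomial in `s` of degree at most `n` with these `n` roots is known up to a factor. The
identity holds for all real `s`, including those where the integral diverges. -/
theorem exists_momentNumerator_eq {a b : ℝ} (ha : -1 < a) (hb : -1 < b) (n : ℕ) :
    ∃ κ : ℝ, ∀ s, momentNumerator b n (jacobiOrthonormal a b n) s
      = κ * ∏ j ∈ Finset.range n, (a + j - s) := by
  have hB := isPolyInner_jacobiInner ha hb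
  set p := jacobiOrthonormal a b n with hp
  have hdeg : p.natDegree ≤ n := ((orthonormalPoly_spec hB).2 n).1.le
  let G : ℝ[X] := ∑ k ∈ Finset.range (n + 1), C ((p.comp (1 - X)).coeff k * 2 ^ k) *
    (∏ j ∈ Finset.range k, (X + C (1 + (j : ℝ)))) * ∏ j ∈ Finset.Ico k n, (X + C (b + 2 + (j : ℝ)))
  have hG : ∀ s, G.eval s = momentNumerator b n p s := by
    intro s
    simp only [G, momentNumerator, eval_finsetSum, eval_mul, eval_C, eval_prod, eval_add, eval_X,
      ← add_assoc]
  have hGd : G.natDegree ≤ n := by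
    refine natDegree_sum_le_of_forall_le _ _ fun k hk => ?_
    have hk' : k ≤ n := by simpa [Nat.lt_succ_iff] using hk
    have e1 : (∏ j ∈ Finset.range k, (X + C (1 + (j : ℝ)))).natDegree ≤ k := by
      refine (natDegree_prod_le _ _).trans ?_
      simp only [natDegree_X_add_C, Finset.sum_const, Finset.card_range, smul_eq_mul,
        mul_one, le_refl]
    have e2 : (∏ j ∈ Finset.Ico k n, (X + C (b + 2 + (j : ℝ)))).natDegree ≤ n - k := by
      refine (natDegree_prod_le _ _).trans ?_
      simp only [natDegree_X_add_C, Finset.sum_const, Nat.card_Ico, smul_eq_mul,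
        mul_one, le_refl]
    refine natDegree_mul_le.trans ?_
    have := natDegree_C_mul_le ((p.comp (1 - X)).coeff k * 2 ^ k)
      (∏ j ∈ Finset.range k, (X + C (1 + (j : ℝ))))
    omega
  let Q : ℝ[X] := ∏ j ∈ Finset.range n, (X - C (a + j))
  have hQm : Q.Monic := monic_prod_of_monic _ _ fun j _ => monic_X_sub_C _
  have hQd : Q.natDegree = n := by
    rw [natDegree_prod_of_monic _ _ fun j _ => monic_X_sub_C _]
    simp only [natDegree_X_sub_C, Finset.sum_const, Finset.card_range, smul_eq_mul, mul_one]
  have hroot : ∀ j ∈ Finset.range n, G.eval (a + j) = 0 := by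
    intro j hj
    have hj' : j < n := by simpa using hj
    have h0 : (0 : ℝ) ≤ j := Nat.cast_nonneg j
    have h1 := jacobiMoment_eq_numerator hb (s := a + j) (by linarith) hdeg
    have h2 : jacobiMoment (a + j) b p = 0 := by
      rw [← jacobiMoment_one_sub_X_pow_mul, mul_comm, ← jacobiInner_eq_moment]
      refine hB.inner_of_degree_lt n ((degree_pow_le _ _).trans_lt ?_)
      have : (1 - X : ℝ[X]).degree = 1 := by
        rw [← neg_sub, degree_neg, ← C_1, degree_X_sub_C]
      rw [this]
      simpa using hj'
    have h3 : 2 ^ (a + j + b + 1) * Real.Gamma (a + j + 1) * Real.Gamma (b + 1)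
        / Real.Gamma (a + j + b + 2 + n) ≠ 0 := by
      have := Real.Gamma_pos_of_pos (show 0 < a + j + 1 by linarith)
      have := Real.Gamma_pos_of_pos (show 0 < b + 1 by linarith)
      have := Real.Gamma_pos_of_pos (show 0 < a + j + b + 2 + n by
        linarith [(Nat.cast_nonneg n : (0 : ℝ) ≤ n)])
      positivity
    rw [h2] at h1
    rw [hG]
    exact (mul_eq_zero.1 h1.symm).resolve_left h3
  -- The difference has degree below `n` and vanishes at the `n` points `a + j`.
  have hGQ : G = C (G.coeff n) * Q := by
    refine eq_of_degree_sub_lt_of_eval_finset_eq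
      ((Finset.range n).image fun j : ℕ => a + (j : ℝ)) ?_ ?_
    · rw [Finset.card_image_of_injective _ fun i j h => by simpa using h, Finset.card_range,
        degree_lt_iff_coeff_zero]
      intro k hk
      rcases hk.eq_or_lt with rfl | hk
      · have : Q.coeff n = 1 := by
          have := hQm.coeff_natDegree
          rwa [hQd] at this
        simp [this]
      · rw [coeff_sub, coeff_C_mul, coeff_eq_zero_of_natDegree_lt (hGd.trans_lt hk),
          coeff_eq_zero_of_natDegree_lt (hQd.trans_lt hk)]
        simp
    · intro x hx
      obtain ⟨j, hj, rfl⟩ := Finset.mem_image.1 hx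
      rw [hroot j hj, eval_mul, eval_prod, Finset.prod_eq_zero hj (by simp), mul_zero]
  -- The sign comes from reversing the `n` factors `s - (a + j)`.
  refine ⟨G.coeff n * (-1) ^ n, fun s => ?_⟩
  rw [← hG, congrArg (eval s) hGQ, eval_mul, eval_C, eval_prod]
  rw [mul_assoc]
  congr 1
  simp only [eval_sub, eval_X, eval_C]
  have h := Finset.prod_neg (s := Finset.range n) (fun j : ℕ => s - (a + j))
  simp only [neg_sub, Finset.card_range] at h
  rw [show ∏ j ∈ Finset.range n, (a + (j : ℝ) - s) = _ from h, ← mul_assoc, ← pow_add, ← two_mul,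
    pow_mul]
  simp

/-- The factor `s + 1` kills every term with `k ≥ 1`, leaving the constant Taylor coefficient at 1.
-/
theorem momentNumerator_neg_one (b : ℝ) (n : ℕ) (f : ℝ[X]) :
    momentNumerator b n f (-1) = f.eval 1 * ∏ j ∈ Finset.range n, (b + 1 + j) := by
  rw [momentNumerator, Finset.sum_eq_single 0]
  · rw [coeff_zero_eq_eval_zero, eval_comp, Finset.range_eq_Ico]
    simp
    left
    refine Finset.prod_congr rfl fun j _ => by ring
  · intro k _ hk
    rw [Finset.prod_eq_zero (Finset.mem_range.2 (Nat.pos_of_ne_zero hk)) (by simp)]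
    ring
  · simp

/-- The factor `s + 2` kills every term with `k ≥ 2`, leaving the first two Taylor coefficients at
1. -/
theorem momentNumerator_neg_two (b : ℝ) (n : ℕ) (f : ℝ[X]) :
    momentNumerator b (n + 1) f (-2) = (f.eval 1 * b + 2 * (derivative f).eval 1) *
      ∏ j ∈ Finset.range n, (b + 1 + j) := by
  have h1 : (f.comp (1 - X)).coeff 1 = -(derivative f).eval 1 := by
    have h := coeff_derivative (f.comp (1 - X)) 0
    rw [derivative_comp, coeff_zero_eq_eval_zero] at h
    simp at h
    exact h.symm
  rw [momentNumerator, Finset.sum_range_succ', Finset.sum_range_succ', Finset.sum_eq_zero]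
  · have e1 : ∏ j ∈ Finset.Ico 1 (n + 1), (-2 + b + 2 + (j : ℝ)) =
        ∏ j ∈ Finset.range n, (b + 1 + (j : ℝ)) := by
      rw [Finset.prod_Ico_eq_prod_range]
      refine Finset.prod_congr rfl fun j _ => ?_
      push_cast; ring
    have e0 : ∏ j ∈ Finset.Ico 0 (n + 1), (-2 + b + 2 + (j : ℝ)) =
        b * ∏ j ∈ Finset.range n, (b + 1 + (j : ℝ)) := by
      rw [Finset.prod_eq_prod_Ico_succ_bot (by omega), zero_add, e1]
      simp
    rw [coeff_zero_eq_eval_zero, eval_comp, zero_add, h1, e1, e0]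
    simp
    ring
  · intro k _
    rw [Finset.prod_eq_zero (s := Finset.range (k + 1 + 1)) (i := 1)
      (Finset.mem_range.2 (by omega)) (by norm_num)]
    ring

theorem coeff_comp_one_sub_X {f : ℝ[X]} {n : ℕ} (hf : f.natDegree = n) :
    (f.comp (1 - X)).coeff n = (-1) ^ n * f.coeff n := by
  have h1 : (1 - X : ℝ[X]).natDegree = 1 := by
    rw [← neg_sub, natDegree_neg, ← C_1, natDegree_X_sub_C]
  have h2 := leadingCoeff_comp (p := f) (q := (1 - X : ℝ[X])) (by simp [h1])
  have h3 : (1 - X : ℝ[X]).leadingCoeff = -1 := by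
    rw [← neg_sub, leadingCoeff_neg, ← C_1, leadingCoeff_X_sub_C]
  rw [leadingCoeff, natDegree_comp, h1, mul_one, hf, h3, leadingCoeff, hf] at h2
  rw [h2, mul_comm]

/-- Here the factor `s + b + 2 + (n - 1)` vanishes, and it occurs in every term with `k < n`; only
the leading coefficient survives. -/
theorem momentNumerator_top (b : ℝ) {n : ℕ} {f : ℝ[X]} (hf : f.natDegree = n) :
    momentNumerator b n f (-b - n - 1) = f.coeff n * 2 ^ n * ∏ j ∈ Finset.range n, (b + 1 + j) := by
  rw [momentNumerator, Finset.sum_eq_single n]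
  · rw [coeff_comp_one_sub_X hf, ← Finset.prod_range_reflect]
    have h := Finset.prod_neg (s := Finset.range n) (fun j : ℕ => b + 1 + (j : ℝ))
    rw [Finset.card_range] at h
    have h' : ∏ j ∈ Finset.range n, (-b - n - 1 + 1 + ((n - 1 - j : ℕ) : ℝ))
        = ∏ j ∈ Finset.range n, -(b + 1 + (j : ℝ)) := by
      refine Finset.prod_congr rfl fun j hj => ?_
      have : j < n := by simpa using hj
      rw [Nat.sub_sub, Nat.cast_sub (by omega)]
      push_cast; ring
    rw [h', h]
    have : ((-1 : ℝ) ^ n) * (-1) ^ n = 1 := by rw [← mul_pow]; simp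
    simp only [Finset.Ico_self, Finset.prod_empty, mul_one]
    linear_combination (f.coeff n * 2 ^ n * ∏ j ∈ Finset.range n, (b + 1 + (j : ℝ))) * this
  · intro k hk hkn
    have hk' : k < n := by have := Finset.mem_range.1 hk; omega
    rw [Finset.prod_eq_zero (s := Finset.Ico k n) (i := n - 1) (Finset.mem_Ico.2 (by omega))]
    · ring
    · rw [Nat.cast_sub (by omega)]; push_cast; ring
  · simp

/-! ### Closed forms for Jacobi polynomials -/

section Values

variable {a b : ℝ}

theorem jacobiOrthonormal_natDegree (ha : -1 < a) (hb : -1 < b) (n : ℕ) :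
    (jacobiOrthonormal a b n).natDegree = n :=
  ((orthonormalPoly_spec (isPolyInner_jacobiInner ha hb)).2 n).1

theorem jacobiOrthonormal_coeff_pos (ha : -1 < a) (hb : -1 < b) (n : ℕ) :
    0 < (jacobiOrthonormal a b n).coeff n :=
  (isPolyInner_jacobiInner ha hb).coeff_pos n

/-- The constant in the factorization of the moment numerator of a Jacobi polynomial. -/
theorem exists_jacobi_constant (ha : -1 < a) (hb : -1 < b) (n : ℕ) :
    ∃ κ : ℝ, 0 < κ ∧
      (∀ s, momentNumerator b n (jacobiOrthonormal a b n) s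
        = κ * ∏ j ∈ Finset.range n, (a + j - s)) ∧
      (jacobiOrthonormal a b n).coeff n * 2 ^ n * ∏ j ∈ Finset.range n, (b + 1 + j)
        = κ * ∏ j ∈ Finset.range n, (a + b + n + 1 + j) ∧
      (jacobiOrthonormal a b n).eval 1 * ∏ j ∈ Finset.range n, (b + 1 + j)
        = κ * ∏ j ∈ Finset.range n, (a + 1 + j) := by
  obtain ⟨κ, hκ⟩ := exists_momentNumerator_eq ha hb n
  have h1 := momentNumerator_top b (jacobiOrthonormal_natDegree ha hb n)
  have h2 := momentNumerator_neg_one b n (jacobiOrthonormal a b n)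
  rw [hκ] at h1 h2
  have e1 : ∏ j ∈ Finset.range n, (a + j - (-b - n - 1)) =
      ∏ j ∈ Finset.range n, (a + b + n + 1 + (j : ℝ)) :=
    Finset.prod_congr rfl fun j _ => by ring
  have e2 : ∏ j ∈ Finset.range n, (a + j - (-1)) =
      ∏ j ∈ Finset.range n, (a + 1 + (j : ℝ)) :=
    Finset.prod_congr rfl fun j _ => by ring
  rw [e1] at h1
  rw [e2] at h2
  refine ⟨κ, ?_, hκ, h1.symm, h2.symm⟩
  have p1 : 0 < ∏ j ∈ Finset.range n, (b + 1 + (j : ℝ)) :=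
    Finset.prod_pos fun j _ => by have := Nat.cast_nonneg (α := ℝ) j; linarith
  have p2 : 0 < ∏ j ∈ Finset.range n, (a + b + n + 1 + (j : ℝ)) := by
    -- `a + b + 1` may be negative, but a factor exists only if `n ≥ 1`, and then `a + b + n + 1 >
    -- 0`.
    refine Finset.prod_pos fun j hj => ?_
    have h1 : (1 : ℝ) ≤ n := by
      have := Finset.mem_range.1 hj
      exact_mod_cast (by omega : 1 ≤ n)
    have := Nat.cast_nonneg (α := ℝ) j
    linarith
  have := jacobiOrthonormal_coeff_pos ha hb n
  exact pos_of_mul_pos_left (h1 ▸ by positivity) p2.le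

theorem jacobiOrthonormal_eval_one_pos (ha : -1 < a) (hb : -1 < b) (n : ℕ) :
    0 < (jacobiOrthonormal a b n).eval 1 := by
  obtain ⟨κ, hκ, -, -, h⟩ := exists_jacobi_constant ha hb n
  have p1 : 0 < ∏ j ∈ Finset.range n, (b + 1 + (j : ℝ)) :=
    Finset.prod_pos fun j _ => by have := Nat.cast_nonneg (α := ℝ) j; linarith
  have p2 : 0 < ∏ j ∈ Finset.range n, (a + 1 + (j : ℝ)) :=
    Finset.prod_pos fun j _ => by have := Nat.cast_nonneg (α := ℝ) j; linarith
  exact pos_of_mul_pos_left (h ▸ by positivity) p1.le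

/-- The root products at `s = -2` and `s = -1` differ by a shift of the index, so their quotient
telescopes to `(a + 1 + n) / (a + 1)`. -/
theorem jacobiOrthonormal_derivative_eval_one (ha : -1 < a) (hb : -1 < b) {n : ℕ} (hn : 1 ≤ n) :
    (derivative (jacobiOrthonormal a b n)).eval 1 =
      (jacobiOrthonormal a b n).eval 1 * (n * (n + a + b + 1) / (2 * (a + 1))) := by
  obtain ⟨m, rfl⟩ := Nat.exists_eq_add_of_le' hn
  obtain ⟨κ, hκ, hs, -, h⟩ := exists_jacobi_constant ha hb (m + 1)
  have h2 := momentNumerator_neg_two b m (jacobiOrthonormal a b (m + 1))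
  rw [hs] at h2
  have e2 : ∏ j ∈ Finset.range (m + 1), (a + j - (-2)) =
      ∏ j ∈ Finset.range (m + 1), (a + 1 + ((j + 1 : ℕ) : ℝ)) :=
    Finset.prod_congr rfl fun j _ => by push_cast; ring
  have e3 := Finset.prod_range_succ' (fun j : ℕ => a + 1 + (j : ℝ)) (m + 1)
  rw [Finset.prod_range_succ] at e3
  rw [e2] at h2
  rw [Finset.prod_range_succ] at h
  have p1 : 0 < ∏ j ∈ Finset.range m, (b + 1 + (j : ℝ)) :=
    Finset.prod_pos fun j _ => by have := Nat.cast_nonneg (α := ℝ) j; linarith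
  have ha' : a + 1 ≠ 0 := by linarith
  push_cast at *
  set R := ∏ j ∈ Finset.range m, (b + 1 + (j : ℝ))
  have key : (jacobiOrthonormal a b (m + 1)).eval 1 * (b + 1 + m) * (a + 1 + (m + 1)) =
      (a + 1) * ((jacobiOrthonormal a b (m + 1)).eval 1 * b
        + 2 * (derivative (jacobiOrthonormal a b (m + 1))).eval 1) := by
    refine mul_right_cancel₀ p1.ne' ?_
    linear_combination (a + 1 + (m + 1)) * h + (a + 1) * h2 + κ * e3
  field_simp
  linear_combination -key

theorem jacobiMoment_jacobiOrthonormal (ha : -1 < a) (hb : -1 < b) (n : ℕ) :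
    jacobiMoment (a + n) b (jacobiOrthonormal a b n)
      = (-1) ^ n / (jacobiOrthonormal a b n).coeff n := by
  have h1 : (1 - X : ℝ[X]).natDegree = 1 := by
    rw [← neg_sub, natDegree_neg, ← C_1, natDegree_X_sub_C]
  have h3 : (1 - X : ℝ[X]).leadingCoeff = -1 := by
    rw [← neg_sub, leadingCoeff_neg, ← C_1, leadingCoeff_X_sub_C]
  have h4 : ((1 - X : ℝ[X]) ^ n).natDegree = n := by rw [natDegree_pow, h1, mul_one]
  have h5 : ((1 - X : ℝ[X]) ^ n).coeff n = (-1) ^ n := by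
    rw [← h3, ← leadingCoeff_pow, leadingCoeff, h4]
  rw [← jacobiMoment_one_sub_X_pow_mul, mul_comm, ← jacobiInner_eq_moment, ← h5]
  exact (isPolyInner_jacobiInner ha hb).inner_of_natDegree_le h4.le

/-- The last identity is the normalization: it compares two expressions for the moment at `s = a +
n`. With the leading coefficient formula it determines both `κ` and the leading coefficient. -/
theorem exists_jacobi_constant_Gamma (ha : -1 < a) (hb : -1 < b) {n : ℕ} (hn : 1 ≤ n) :
    ∃ κ : ℝ, 0 < κ ∧
      (∀ s, -1 < s → jacobiMoment s b (jacobiOrthonormal a b n) =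
        2 ^ (s + b + 1) * Real.Gamma (s + 1) * Real.Gamma (b + 1)
          / Real.Gamma (s + b + 2 + n) * (κ * ∏ j ∈ Finset.range n, (a + j - s))) ∧
      (jacobiOrthonormal a b n).coeff n * 2 ^ n * Real.Gamma (b + n + 1)
          * Real.Gamma (a + b + n + 1)
        = κ * Real.Gamma (a + b + 2 * n + 1) * Real.Gamma (b + 1) ∧
      (jacobiOrthonormal a b n).eval 1 * Real.Gamma (b + n + 1) * Real.Gamma (a + 1)
        = κ * Real.Gamma (a + n + 1) * Real.Gamma (b + 1) ∧
      Real.Gamma (a + b + 2 * n + 2) = (jacobiOrthonormal a b n).coeff n * κ * n.factorial *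
        2 ^ (a + b + n + 1) * Real.Gamma (a + n + 1) * Real.Gamma (b + 1) := by
  obtain ⟨κ, hκ, hs, h1, h2⟩ := exists_jacobi_constant ha hb n
  have hn' : (1 : ℝ) ≤ n := by exact_mod_cast hn
  have hmom : ∀ s, -1 < s → jacobiMoment s b (jacobiOrthonormal a b n) =
        2 ^ (s + b + 1) * Real.Gamma (s + 1) * Real.Gamma (b + 1)
          / Real.Gamma (s + b + 2 + n) * (κ * ∏ j ∈ Finset.range n, (a + j - s)) := by
    intro s hs'
    rw [jacobiMoment_eq_numerator hb hs' (jacobiOrthonormal_natDegree ha hb n).le, hs]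
  have g1 := Real.Gamma_add_natCast (x := b + 1) (by linarith) n
  have g2 := Real.Gamma_add_natCast (x := a + b + n + 1) (by linarith) n
  have g3 := Real.Gamma_add_natCast (x := a + 1) (by linarith) n
  refine ⟨κ, hκ, hmom, ?_, ?_, ?_⟩
  · rw [show b + n + 1 = b + 1 + n by ring,
      show a + b + 2 * n + 1 = a + b + n + 1 + n by ring, g1, g2]
    linear_combination (Real.Gamma (b + 1) * Real.Gamma (a + b + n + 1)) * h1
  · rw [show b + n + 1 = b + 1 + n by ring, show a + n + 1 = a + 1 + n by ring, g1, g3]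
    linear_combination (Real.Gamma (b + 1) * Real.Gamma (a + 1)) * h2
  · have h3 := hmom (a + n) (by linarith)
    have e : ∏ j ∈ Finset.range n, (a + j - (a + n)) = (-1) ^ n * (n.factorial : ℝ) := by
      have h := Finset.prod_neg (s := Finset.range n) (fun j : ℕ => (n : ℝ) - j)
      rw [Finset.card_range] at h
      have hf : (n.factorial : ℝ) = ∏ j ∈ Finset.range n, ((n : ℝ) - j) := by
        rw [← Finset.prod_range_add_one_eq_factorial, ← Finset.prod_range_reflect, Nat.cast_prod]
        refine Finset.prod_congr rfl fun j hj => ?_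
        have : j < n := by simpa using hj
        rw [Nat.sub_sub, show n - (1 + j) + 1 = n - j by omega, Nat.cast_sub this.le]
      rw [hf, ← h]
      exact Finset.prod_congr rfl fun j _ => by ring
    rw [jacobiMoment_jacobiOrthonormal ha hb, e, show a + n + b + 1 = a + b + n + 1 by ring,
      show a + n + b + 2 + n = a + b + 2 * n + 2 by ring] at h3
    have hl := jacobiOrthonormal_coeff_pos ha hb n
    have hG := Real.Gamma_pos_of_pos (show 0 < a + b + 2 * n + 2 by linarith)
    have : ((-1 : ℝ) ^ n) ≠ 0 := by simp
    generalize Real.Gamma (a + b + 2 * n + 2) = g at h3 hG ⊢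
    field_simp at h3
    linear_combination h3

theorem jacobiOrthonormal_coeff_sq (ha : -1 < a) (hb : -1 < b) {n : ℕ} (hn : 1 ≤ n) :
    (jacobiOrthonormal a b n).coeff n ^ 2 * (2 ^ (a + b + 2 * n + 1) * Real.Gamma (a + b + n + 1)
        * Real.Gamma (a + n + 1) * Real.Gamma (b + n + 1) * n.factorial)
      = Real.Gamma (a + b + 2 * n + 1) * Real.Gamma (a + b + 2 * n + 2) := by
  obtain ⟨κ, hκ, -, h1, -, h3⟩ := exists_jacobi_constant_Gamma ha hb hn
  have hG := Real.Gamma_pos_of_pos (show 0 < b + 1 by linarith)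
  rw [h3, show a + b + 2 * n + 1 = a + b + n + 1 + n by ring, Real.rpow_add_natCast (by norm_num)]
  rw [show a + b + 2 * n + 1 = a + b + n + 1 + n by ring] at h1
  linear_combination (jacobiOrthonormal a b n).coeff n * 2 ^ (a + b + n + 1)
    * Real.Gamma (a + n + 1) * n.factorial * h1

theorem jacobiOrthonormal_eval_one (ha : -1 < a) (hb : -1 < b) {n : ℕ} (hn : 1 ≤ n) :
    (jacobiOrthonormal a b n).eval 1 * (Real.Gamma (a + 1) * Real.Gamma (a + b + 2 * n + 1))
      = (jacobiOrthonormal a b n).coeff n * 2 ^ n * Real.Gamma (a + n + 1)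
        * Real.Gamma (a + b + n + 1) := by
  obtain ⟨κ, hκ, -, h1, h2, -⟩ := exists_jacobi_constant_Gamma ha hb hn
  have hn' : (1 : ℝ) ≤ n := by exact_mod_cast hn
  have hG := Real.Gamma_pos_of_pos (show 0 < b + 1 by linarith)
  have hG' := Real.Gamma_pos_of_pos (show 0 < b + n + 1 by linarith)
  refine mul_right_cancel₀ (mul_pos (mul_pos hG hG') hκ).ne' ?_
  linear_combination (Real.Gamma (a + b + 2 * n + 1) * κ * Real.Gamma (b + 1)) * h2 -
    κ * Real.Gamma (b + 1) * Real.Gamma (a + n + 1) * h1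

theorem jacobiMoment_sub_one (ha : 0 < a) (hb : -1 < b) {n : ℕ} (hn : 1 ≤ n) :
    jacobiMoment (a - 1) b (jacobiOrthonormal a b n) * ((jacobiOrthonormal a b n).coeff n *
        2 ^ (n + 1) * Real.Gamma (a + n + 1) * Real.Gamma (a + b + n + 1))
      = Real.Gamma a * Real.Gamma (a + b + 2 * n + 2) := by
  obtain ⟨κ, hκ, h, -, -, h3⟩ := exists_jacobi_constant_Gamma (by linarith : -1 < a) hb hn
  have hn' : (1 : ℝ) ≤ n := by exact_mod_cast hn
  have hG := Real.Gamma_pos_of_pos (show 0 < a + b + n + 1 by linarith)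
  have e : ∏ j ∈ Finset.range n, (a + j - (a - 1)) = (n.factorial : ℝ) := by
    rw [← Finset.prod_range_add_one_eq_factorial, Nat.cast_prod]
    exact Finset.prod_congr rfl fun j _ => by push_cast; ring
  rw [h _ (by linarith), e, h3, show a - 1 + b + 2 + n = a + b + n + 1 by ring, sub_add_cancel,
    show a - 1 + b + 1 = a + b by ring, show a + b + n + 1 = a + b + (n + 1 : ℕ) by push_cast; ring,
    Real.rpow_add_natCast (by norm_num)]
  rw [show a + b + n + 1 = a + b + (n + 1 : ℕ) by push_cast; ring] at hG
  field_simp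

theorem jacobiMoment_sub_two (ha : 1 < a) (hb : -1 < b) {n : ℕ} (hn : 1 ≤ n) :
    jacobiMoment (a - 2) b (jacobiOrthonormal a b n) * ((jacobiOrthonormal a b n).coeff n *
        2 ^ (n + 2) * Real.Gamma (a + n + 1) * Real.Gamma (a + b + n))
      = (n + 1) * Real.Gamma (a - 1) * Real.Gamma (a + b + 2 * n + 2) := by
  obtain ⟨κ, hκ, h, -, -, h3⟩ := exists_jacobi_constant_Gamma (by linarith : -1 < a) hb hn
  have hn' : (1 : ℝ) ≤ n := by exact_mod_cast hn
  have hG := Real.Gamma_pos_of_pos (show 0 < a + b + n by linarith)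
  have e : ∏ j ∈ Finset.range n, (a + j - (a - 2)) = ((n + 1).factorial : ℝ) := by
    rw [← Finset.prod_range_add_one_eq_factorial, Nat.cast_prod, Finset.prod_range_succ']
    simp only [zero_add, Nat.cast_one, mul_one]
    exact Finset.prod_congr rfl fun j _ => by push_cast; ring
  rw [h _ (by linarith), e, h3, show a - 2 + b + 2 + n = a + b + n by ring,
    show a - 2 + 1 = a - 1 by ring,
    show a - 2 + b + 1 = a + b - 1 by ring,
    show a + b + n + 1 = a + b - 1 + (n + 2 : ℕ) by push_cast; ring,
    Real.rpow_add_natCast (by norm_num), Nat.factorial_succ]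
  push_cast
  field_simp

end Values

/-! ### Expansion of the Jacobi-Sobolev polynomials -/

theorem coeff_X_sub_one_pow_mul (k : ℕ) {m : ℕ} {f : ℝ[X]} (hf : f.natDegree ≤ m) :
    ((X - 1) ^ k * f).coeff (k + m) = f.coeff m := by
  have h1 : ((X - 1 : ℝ[X]) ^ k).natDegree = k := by
    rw [natDegree_pow, ← C_1, natDegree_X_sub_C, mul_one]
  have h2 : ((X - 1 : ℝ[X]) ^ k).coeff k = 1 := by
    have h := ((monic_X_sub_C (1 : ℝ)).pow k).coeff_natDegree
    rwa [C_1, h1] at h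
  rw [coeff_mul_add_eq_of_natDegree_le h1.le hf, h2, one_mul]

theorem natDegree_X_sub_one_pow_mul_le (k : ℕ) {m : ℕ} {f : ℝ[X]} (hf : f.natDegree ≤ m) :
    ((X - 1) ^ k * f).natDegree ≤ k + m := by
  have h1 : ((X - 1 : ℝ[X]) ^ k).natDegree = k := by
    rw [natDegree_pow, ← C_1, natDegree_X_sub_C, mul_one]
  exact natDegree_mul_le.trans (by omega)

theorem degree_X_sub_one_pow_mul_lt (k : ℕ) {m n : ℕ} (hn : k + m = n) {f : ℝ[X]}
    (hf : f.degree < m) : ((X - 1) ^ k * f).degree < (n : WithBot ℕ) := by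
  rcases eq_or_ne f 0 with rfl | hf0
  · rw [mul_zero, degree_zero]
    exact WithBot.bot_lt_coe n
  · rw [degree_lt_iff_coeff_zero]
    intro j hj
    have := (natDegree_lt_iff_degree_lt hf0).2 hf
    have := natDegree_X_sub_one_pow_mul_le k (le_refl f.natDegree)
    exact coeff_eq_zero_of_natDegree_lt (by omega)

/-- A polynomial vanishing at `1` is divisible by `X - 1`, with a quotient of smaller degree. -/
theorem exists_eq_X_sub_one_mul {f : ℝ[X]} {n : ℕ} (hf : f.natDegree ≤ n + 1)
    (h : f.eval 1 = 0) : ∃ g : ℝ[X], g.natDegree ≤ n ∧ f = (X - 1) * g := by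
  obtain ⟨g, rfl⟩ := dvd_iff_isRoot.2 (show IsRoot f 1 from h)
  refine ⟨g, ?_, by rw [C_1]⟩
  rcases eq_or_ne g 0 with rfl | hg
  · simp
  · rw [natDegree_mul (X_sub_C_ne_zero 1) hg, natDegree_X_sub_C] at hf
    omega

section Expansion

variable {α β : ℝ}

/-- Two divisions by `X - 1` are made possible by subtracting multiples of `p` and `r`, whose values
at 1 are nonzero. Both subtracted terms satisfy the orthogonality in `h`, so the remainder inherits
it. -/
theorem exists_jacobi_expansion (hα : -1 < α) (hβ : -1 < β) (m : ℕ) {f : ℝ[X]}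
    (hf : f.natDegree ≤ m + 2)
    (h : ∀ g : ℝ[X], g.degree < m → jacobiInner α β f ((X - 1) ^ 2 * g) = 0) :
    ∃ a b c : ℝ, f = C a * jacobiOrthonormal α β (m + 2)
      + C b * (X - 1) * jacobiOrthonormal (α + 2) β (m + 1)
      + C c * (X - 1) ^ 2 * jacobiOrthonormal (α + 4) β m := by
  have hB := isPolyInner_jacobiInner hα hβ
  have hB2 := isPolyInner_jacobiInner (show -1 < α + 2 by linarith) hβ
  set p := jacobiOrthonormal α β (m + 2) with hp
  set r := jacobiOrthonormal (α + 2) β (m + 1) with hr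
  have hpd : p.natDegree = m + 2 := jacobiOrthonormal_natDegree hα hβ _
  have hrd : r.natDegree = m + 1 := jacobiOrthonormal_natDegree (by linarith) hβ _
  have hp1 : 0 < p.eval 1 := jacobiOrthonormal_eval_one_pos hα hβ _
  have hr1 : 0 < r.eval 1 := jacobiOrthonormal_eval_one_pos (by linarith) hβ _
  obtain ⟨g, hgd, hg⟩ := exists_eq_X_sub_one_mul (f := f - C (f.eval 1 / p.eval 1) * p) (n := m + 1)
    ((natDegree_sub_le _ _).trans (max_le hf ((natDegree_C_mul_le _ _).trans hpd.le)))
    (by simp [hp1.ne'])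
  obtain ⟨e, hed, he⟩ := exists_eq_X_sub_one_mul (f := g - C (g.eval 1 / r.eval 1) * r) (n := m)
    ((natDegree_sub_le _ _).trans (max_le hgd ((natDegree_C_mul_le _ _).trans hrd.le)))
    (by simp [hr1.ne'])
  have hfe : f = C (f.eval 1 / p.eval 1) * p + C (g.eval 1 / r.eval 1) * ((X - 1) * r)
      + (X - 1) ^ 2 * e := by
    linear_combination hg + (X - 1) * he
  have horth : ∀ t : ℝ[X], t.degree < m → jacobiInner (α + 4) β e t = 0 := by
    intro t ht
    have h0 := h t ht
    have htd : ((X - 1) ^ 2 * t).degree < ((m + 2 : ℕ) : WithBot ℕ) :=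
      degree_X_sub_one_pow_mul_lt 2 (by omega) ht
    have htd' : ((X - 1) * t).degree < ((m + 1 : ℕ) : WithBot ℕ) := by
      simpa using degree_X_sub_one_pow_mul_lt 1 (n := m + 1) (by omega) ht
    have h1 : jacobiInner α β p ((X - 1) ^ 2 * t) = 0 := hB.inner_of_degree_lt _ htd
    have h2 : jacobiInner α β ((X - 1) * r) ((X - 1) ^ 2 * t) = 0 := by
      rw [jacobiInner_eq_moment, show (X - 1) * r * ((X - 1) ^ 2 * t)
        = (X - 1) ^ 2 * (r * ((X - 1) * t)) by ring, jacobiMoment_X_sub_one_sq_mul,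
        ← jacobiInner_eq_moment]
      exact hB2.inner_of_degree_lt _ htd'
    have h3 : jacobiInner α β ((X - 1) ^ 2 * e) ((X - 1) ^ 2 * t)
        = jacobiInner (α + 4) β e t := by
      rw [jacobiInner_eq_moment, show (X - 1) ^ 2 * e * ((X - 1) ^ 2 * t)
        = (X - 1) ^ 2 * ((X - 1) ^ 2 * (e * t)) by ring, jacobiMoment_X_sub_one_sq_mul,
        jacobiMoment_X_sub_one_sq_mul, ← jacobiInner_eq_moment]
      ring_nf
    rw [hfe, hB.add_left, hB.add_left, hB.smul_left, hB.smul_left, h1, h2, h3] at h0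
    simpa using h0
  obtain ⟨c, hc⟩ := (isPolyInner_jacobiInner (show -1 < α + 4 by linarith)
    hβ).eq_smul_of_orthogonal hed horth
  refine ⟨f.eval 1 / p.eval 1, g.eval 1 / r.eval 1, c, hfe.trans ?_⟩
  rw [hc, jacobiOrthonormal]
  ring

/-- Evaluation at 1, alternated with cancellation of `X - 1`, isolates the coefficients one at a
time. -/
theorem jacobi_expansion_unique (hα : -1 < α) (hβ : -1 < β) (m : ℕ) {a b c a' b' c' : ℝ}
    (h : C a * jacobiOrthonormal α β (m + 2)
        + C b * (X - 1) * jacobiOrthonormal (α + 2) β (m + 1)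
        + C c * (X - 1) ^ 2 * jacobiOrthonormal (α + 4) β m
      = C a' * jacobiOrthonormal α β (m + 2)
        + C b' * (X - 1) * jacobiOrthonormal (α + 2) β (m + 1)
        + C c' * (X - 1) ^ 2 * jacobiOrthonormal (α + 4) β m) :
    a = a' ∧ b = b' ∧ c = c' := by
  set p := jacobiOrthonormal α β (m + 2) with hp
  set r := jacobiOrthonormal (α + 2) β (m + 1) with hr
  set s := jacobiOrthonormal (α + 4) β m with hs
  have hp1 : 0 < p.eval 1 := jacobiOrthonormal_eval_one_pos hα hβ _
  have hr1 : 0 < r.eval 1 := jacobiOrthonormal_eval_one_pos (by linarith) hβ _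
  have hs1 : 0 < s.eval 1 := jacobiOrthonormal_eval_one_pos (by linarith) hβ _
  have hX : (X - 1 : ℝ[X]) ≠ 0 := by
    rw [← C_1]; exact X_sub_C_ne_zero 1
  have ha : a = a' := by
    have := congrArg (eval 1) h
    simpa [hp1.ne'] using this
  subst ha
  have h2 : C b * r + C c * (X - 1) * s = C b' * r + C c' * (X - 1) * s :=
    mul_left_cancel₀ hX (by linear_combination h)
  have hb : b = b' := by
    have := congrArg (eval 1) h2
    simpa [hr1.ne'] using this
  subst hb
  have h3 : C c * s = C c' * s := mul_left_cancel₀ hX (by linear_combination h2)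
  have := congrArg (eval 1) h3
  exact ⟨rfl, rfl, by simpa [hs1.ne'] using this⟩

variable {M N : ℝ}

theorem jacobiSobolevInner_X_sub_one_sq_mul (f g : ℝ[X]) :
    jacobiSobolevInner α β M N f ((X - 1) ^ 2 * g) = jacobiInner α β f ((X - 1) ^ 2 * g) := by
  simp [jacobiSobolevInner, derivative_mul, derivative_pow]

theorem exists_jacobiSobolev_expansion (hα : -1 < α) (hβ : -1 < β) (hM : 0 ≤ M) (hN : 0 ≤ N)
    (m : ℕ) : ∃ a b c : ℝ, jacobiSobolevOrthonormal α β M N (m + 2) =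
      C a * jacobiOrthonormal α β (m + 2)
      + C b * (X - 1) * jacobiOrthonormal (α + 2) β (m + 1)
      + C c * (X - 1) ^ 2 * jacobiOrthonormal (α + 4) β m := by
  have hS := isPolyInner_jacobiSobolevInner hα hβ hM hN
  refine exists_jacobi_expansion hα hβ m ((orthonormalPoly_spec hS).2 _).1.le fun g hg => ?_
  rw [← jacobiSobolevInner_X_sub_one_sq_mul (M := M) (N := N)]
  exact hS.inner_of_degree_lt _ (degree_X_sub_one_pow_mul_lt 2 (by omega) hg)

/-- The orthogonality and normalization conditions, in terms of the coefficients of the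
expansion. -/
theorem jacobiSobolev_relations (hα : -1 < α) (hβ : -1 < β) (hM : 0 ≤ M) (hN : 0 ≤ N)
    {m : ℕ} {a b c : ℝ} (h : jacobiSobolevOrthonormal α β M N (m + 2) =
      C a * jacobiOrthonormal α β (m + 2)
      + C b * (X - 1) * jacobiOrthonormal (α + 2) β (m + 1)
      + C c * (X - 1) ^ 2 * jacobiOrthonormal (α + 4) β m) :
    M * (a * (jacobiOrthonormal α β (m + 2)).eval 1) =
        b * jacobiMoment (α + 1) β (jacobiOrthonormal (α + 2) β (m + 1))
        - c * jacobiMoment (α + 2) β (jacobiOrthonormal (α + 4) β m) ∧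
      N * (a * (derivative (jacobiOrthonormal α β (m + 2))).eval 1
          + b * (jacobiOrthonormal (α + 2) β (m + 1)).eval 1) =
        c * jacobiMoment (α + 3) β (jacobiOrthonormal (α + 4) β m) ∧
      0 < a * (jacobiOrthonormal α β (m + 2)).coeff (m + 2)
        + b * (jacobiOrthonormal (α + 2) β (m + 1)).coeff (m + 1)
        + c * (jacobiOrthonormal (α + 4) β m).coeff m ∧
      (a * (jacobiOrthonormal α β (m + 2)).coeff (m + 2)
        + b * (jacobiOrthonormal (α + 2) β (m + 1)).coeff (m + 1)
        + c * (jacobiOrthonormal (α + 4) β m).coeff m) *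
      (a / (jacobiOrthonormal α β (m + 2)).coeff (m + 2)
        + b / (jacobiOrthonormal (α + 2) β (m + 1)).coeff (m + 1)
        + c / (jacobiOrthonormal (α + 4) β m).coeff m) = 1 := by
  have hS := isPolyInner_jacobiSobolevInner hα hβ hM hN
  have hB := isPolyInner_jacobiInner hα hβ
  have hB2 := isPolyInner_jacobiInner (show -1 < α + 2 by linarith) hβ
  have hB4 := isPolyInner_jacobiInner (show -1 < α + 4 by linarith) hβ
  set q := jacobiSobolevOrthonormal α β M N (m + 2) with hq
  set p := jacobiOrthonormal α β (m + 2) with hp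
  set r := jacobiOrthonormal (α + 2) β (m + 1) with hr
  set s := jacobiOrthonormal (α + 4) β m with hs
  have hpd : p.natDegree = m + 2 := jacobiOrthonormal_natDegree hα hβ _
  have hrd : r.natDegree = m + 1 := jacobiOrthonormal_natDegree (by linarith) hβ _
  have hsd : s.natDegree = m := jacobiOrthonormal_natDegree (by linarith) hβ _
  have hX1 : (X - 1 : ℝ[X]).natDegree = 1 := by rw [← C_1, natDegree_X_sub_C]
  have hlt : ∀ {f : ℝ[X]} {n : ℕ}, f.natDegree < n → f.degree < n := fun hf =>
    degree_le_natDegree.trans_lt (by exact_mod_cast hf)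
  have hmom : ∀ f, jacobiInner α β q f = a * jacobiMoment α β (p * f)
      + b * jacobiMoment α β ((X - 1) * r * f) + c * jacobiMoment α β ((X - 1) ^ 2 * s * f) := by
    intro f
    rw [h, mul_assoc, mul_assoc, hB.add_left, hB.add_left, hB.smul_left, hB.smul_left,
      hB.smul_left]
    simp only [jacobiInner_eq_moment]
  have hq1 : q.eval 1 = a * p.eval 1 := by rw [h]; simp
  have hq1' : (derivative q).eval 1 = a * (derivative p).eval 1 + b * r.eval 1 := by
    rw [h]; simp [derivative_pow]
  have hqc : q.coeff (m + 2) = a * p.coeff (m + 2) + b * r.coeff (m + 1) + c * s.coeff m := by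
    have e1 := coeff_X_sub_one_pow_mul 1 hrd.le
    have e2 := coeff_X_sub_one_pow_mul 2 hsd.le
    rw [pow_one, show 1 + (m + 1) = m + 2 by ring] at e1
    rw [add_comm 2 m] at e2
    rw [h, mul_assoc, mul_assoc, coeff_add, coeff_add, coeff_C_mul, coeff_C_mul, coeff_C_mul, e1,
      e2]
  have hqpos : 0 < q.coeff (m + 2) := hS.coeff_pos _
  refine ⟨?_, ?_, hqc ▸ hqpos, ?_⟩
  · have h0 : jacobiSobolevInner α β M N q 1 = 0 :=
      hS.inner_of_degree_lt _ (hlt (by simp))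
    have h1 : jacobiMoment α β p = 0 := by
      have := hB.inner_of_degree_lt (m + 2) (f := 1) (hlt (by simp))
      rwa [jacobiInner_eq_moment, mul_one] at this
    have h2 := jacobiMoment_X_sub_one_mul hα hβ r
    have h3 := jacobiMoment_X_sub_one_sq_mul α β s
    simp only [jacobiSobolevInner, hmom, mul_one, h1, h2, h3, hq1, eval_one] at h0
    simp at h0
    linear_combination h0
  · have h0 : jacobiSobolevInner α β M N q (X - 1) = 0 :=
      hS.inner_of_degree_lt _ (hlt (by omega))
    have h1 : jacobiMoment α β (p * (X - 1)) = 0 := by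
      rw [← jacobiInner_eq_moment]
      exact hB.inner_of_degree_lt (m + 2) (hlt (by omega))
    have h2 : jacobiMoment α β ((X - 1) * r * (X - 1)) = 0 := by
      have := hB2.inner_of_degree_lt (m + 1) (f := 1) (hlt (by simp))
      rw [jacobiInner_eq_moment, mul_one] at this
      rw [show (X - 1) * r * (X - 1) = (X - 1) ^ 2 * r by ring, jacobiMoment_X_sub_one_sq_mul]
      exact this
    have h3 : jacobiMoment α β ((X - 1) ^ 2 * s * (X - 1)) = -jacobiMoment (α + 3) β s := by
      rw [mul_assoc, jacobiMoment_X_sub_one_sq_mul, mul_comm s,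
        jacobiMoment_X_sub_one_mul (by linarith) hβ]
      ring_nf
    simp only [jacobiSobolevInner, hmom, h1, h2, h3, hq1'] at h0
    simp at h0
    linear_combination h0
  -- The test polynomial `(X - 1) ^ 2 * s` has full degree and ignores the masses. Its product with
  -- each of `q`, `p`, `(X - 1) * r` is a quotient of leading coefficients, and with itself it is 1.
  · have hs2 := natDegree_X_sub_one_pow_mul_le 2 hsd.le
    have hs2c := coeff_X_sub_one_pow_mul 2 hsd.le
    rw [add_comm 2 m] at hs2 hs2c
    have h0 : jacobiSobolevInner α β M N q ((X - 1) ^ 2 * s) = s.coeff m / q.coeff (m + 2) := by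
      rw [← hs2c]
      exact hS.inner_of_natDegree_le hs2
    have h1 : jacobiMoment α β (p * ((X - 1) ^ 2 * s)) = s.coeff m / p.coeff (m + 2) := by
      rw [← jacobiInner_eq_moment, ← hs2c]
      exact hB.inner_of_natDegree_le hs2
    have h2 : jacobiMoment α β ((X - 1) * r * ((X - 1) ^ 2 * s)) = s.coeff m / r.coeff (m + 1) := by
      have hs1 := natDegree_X_sub_one_pow_mul_le 1 hsd.le
      have hs1c := coeff_X_sub_one_pow_mul 1 hsd.le
      rw [pow_one, add_comm 1 m] at hs1 hs1c
      rw [show (X - 1) * r * ((X - 1) ^ 2 * s) = (X - 1) ^ 2 * (r * ((X - 1) * s)) by ring,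
        jacobiMoment_X_sub_one_sq_mul, ← jacobiInner_eq_moment, ← hs1c]
      exact hB2.inner_of_natDegree_le hs1
    have h3 : jacobiMoment α β ((X - 1) ^ 2 * s * ((X - 1) ^ 2 * s)) = 1 := by
      rw [show (X - 1) ^ 2 * s * ((X - 1) ^ 2 * s) = (X - 1) ^ 2 * ((X - 1) ^ 2 * (s * s)) by ring,
        jacobiMoment_X_sub_one_sq_mul, jacobiMoment_X_sub_one_sq_mul,
        show α + 2 + 2 = α + 4 by ring, ← jacobiInner_eq_moment]
      have := (orthonormalPoly_spec hB4).1 m m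
      rwa [if_pos rfl] at this
    rw [jacobiSobolevInner_X_sub_one_sq_mul, hmom, h1, h2, h3] at h0
    rw [← hqc]
    have l1 : 0 < p.coeff (m + 2) := jacobiOrthonormal_coeff_pos hα hβ _
    have l2 : 0 < r.coeff (m + 1) := jacobiOrthonormal_coeff_pos (by linarith) hβ _
    have l3 : 0 < s.coeff m := jacobiOrthonormal_coeff_pos (by linarith) hβ _
    generalize q.coeff (m + 2) = u at h0 hqpos
    field_simp at h0 ⊢
    linear_combination h0

end Expansion

/-! ### Asymptotics of the Jacobi quantities -/

/-- Gauss's limit formula for `Γ(x)`, whose product over `j ≤ n` of `x + j` equals `Γ(x + n + 1) /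
Γ(x)`. -/
theorem tendsto_Gamma_ratio {x : ℝ} (hx : 0 < x) :
    Tendsto (fun n : ℕ => Real.Gamma (x + n + 1) / ((n : ℝ) ^ x * n.factorial)) atTop (𝓝 1) := by
  have hG := Real.Gamma_pos_of_pos hx
  have h := (tendsto_const_nhds (x := Real.Gamma x)).div (Real.GammaSeq_tendsto_Gamma x) hG.ne'
  rw [div_self hG.ne'] at h
  refine h.congr' ?_
  filter_upwards with n
  have h1 := Real.Gamma_add_natCast hx (n + 1)
  push_cast at h1
  rw [Pi.div_apply, Real.GammaSeq, add_assoc, h1, div_div_eq_mul_div]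

/-! ### Exact relations between the Jacobi data entering the three equations -/

section Ratios

variable {a b : ℝ}

/-- Passing from `(a, n + 1)` to `(a + 2, n)` keeps `a + 2 n` fixed, so the large Gamma factors
agree and the quotient is rational in `n`. -/
theorem coeff_sq_ratio (ha : -1 < a) (hb : -1 < b) {n : ℕ} (hn : 1 ≤ n) :
    (jacobiOrthonormal (a + 2) b n).coeff n ^ 2 * ((a + b + n + 2) * (a + n + 2))
      = (jacobiOrthonormal a b (n + 1)).coeff (n + 1) ^ 2 * ((b + n + 1) * (n + 1)) := by
  have h1 := jacobiOrthonormal_coeff_sq (show -1 < a + 2 by linarith) hb hn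
  have h2 := jacobiOrthonormal_coeff_sq ha hb (show 1 ≤ n + 1 by omega)
  have hn' : (1 : ℝ) ≤ n := by exact_mod_cast hn
  have g1 := Real.Gamma_add_one (by linarith : a + b + n + 2 ≠ 0)
  have g2 := Real.Gamma_add_one (by linarith : a + n + 2 ≠ 0)
  have g3 := Real.Gamma_add_one (by linarith : b + n + 1 ≠ 0)
  have p1 := Real.Gamma_pos_of_pos (by linarith : 0 < a + b + n + 2)
  have p2 := Real.Gamma_pos_of_pos (by linarith : 0 < a + n + 2)
  have p3 := Real.Gamma_pos_of_pos (by linarith : 0 < b + n + 1)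
  have p4 : (0 : ℝ) < n.factorial := by exact_mod_cast n.factorial_pos
  have p5 : (0 : ℝ) < 2 ^ (a + b + 2 * n + 3) := Real.rpow_pos_of_pos (by norm_num) _
  rw [Nat.factorial_succ] at h2
  push_cast at h2
  rw [show a + 2 + b + 2 * n + 1 = a + b + 2 * n + 3 by ring,
    show a + 2 + b + 2 * n + 2 = a + b + 2 * n + 4 by ring,
    show a + 2 + b + n + 1 = a + b + n + 2 + 1 by ring,
    show a + 2 + n + 1 = a + n + 2 + 1 by ring, g1, g2] at h1
  rw [show a + b + 2 * ((n : ℝ) + 1) + 1 = a + b + 2 * n + 3 by ring,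
    show a + b + 2 * ((n : ℝ) + 1) + 2 = a + b + 2 * n + 4 by ring,
    show a + b + ((n : ℝ) + 1) + 1 = a + b + n + 2 by ring,
    show a + ((n : ℝ) + 1) + 1 = a + n + 2 by ring,
    show b + ((n : ℝ) + 1) + 1 = b + n + 1 + 1 by ring, g3, ← h1] at h2
  refine mul_right_cancel₀ (b := 2 ^ (a + b + 2 * n + 3) * Real.Gamma (a + b + n + 2)
    * Real.Gamma (a + n + 2) * Real.Gamma (b + n + 1) * n.factorial) (by positivity) ?_
  linear_combination -h2

theorem eval_one_ratio (ha : -1 < a) (hb : -1 < b) {n : ℕ} (hn : 1 ≤ n) :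
    (jacobiOrthonormal (a + 2) b n).eval 1
        * ((jacobiOrthonormal a b (n + 1)).coeff (n + 1) * ((a + 2) * (n + 1)))
      = (derivative (jacobiOrthonormal a b (n + 1))).eval 1
        * ((jacobiOrthonormal (a + 2) b n).coeff n * (a + n + 2)) := by
  have h1 := jacobiOrthonormal_eval_one (show -1 < a + 2 by linarith) hb hn
  have h2 := jacobiOrthonormal_eval_one ha hb (show 1 ≤ n + 1 by omega)
  have hn' : (1 : ℝ) ≤ n := by exact_mod_cast hn
  rw [jacobiOrthonormal_derivative_eval_one ha hb (show 1 ≤ n + 1 by omega)]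
  have g1 := Real.Gamma_add_one (by linarith : a + b + n + 2 ≠ 0)
  have g2 := Real.Gamma_add_one (by linarith : a + n + 2 ≠ 0)
  have g3 := Real.Gamma_add_one (by linarith : a + 1 ≠ 0)
  have g4 := Real.Gamma_add_one (by linarith : a + 1 + 1 ≠ 0)
  have p1 := Real.Gamma_pos_of_pos (by linarith : 0 < a + b + n + 2)
  have p2 := Real.Gamma_pos_of_pos (by linarith : 0 < a + n + 2)
  have p3 := Real.Gamma_pos_of_pos (by linarith : 0 < a + 1)
  have p4 := Real.Gamma_pos_of_pos (by linarith : 0 < a + b + 2 * n + 3)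
  have hl := jacobiOrthonormal_coeff_pos ha hb (n + 1)
  push_cast at h2 ⊢
  rw [show a + 2 + 1 = a + 1 + 1 + 1 by ring, g4, g3,
    show a + 2 + b + 2 * n + 1 = a + b + 2 * n + 3 by ring,
    show a + 2 + b + n + 1 = a + b + n + 2 + 1 by ring,
    show a + 2 + n + 1 = a + n + 2 + 1 by ring, g1, g2] at h1
  rw [show a + b + 2 * ((n : ℝ) + 1) + 1 = a + b + 2 * n + 3 by ring,
    show a + b + ((n : ℝ) + 1) + 1 = a + b + n + 2 by ring,
    show a + ((n : ℝ) + 1) + 1 = a + n + 2 by ring] at h2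
  have ha1 : a + 1 ≠ 0 := by linarith
  set lr := (jacobiOrthonormal (a + 2) b n).coeff n
  set lp := (jacobiOrthonormal a b (n + 1)).coeff (n + 1)
  set p := (jacobiOrthonormal a b (n + 1)).eval 1
  obtain ⟨D, hD⟩ : ∃ D, D = ((n : ℝ) + 1) * (n + 1 + a + b + 1) / (2 * (a + 1)) := ⟨_, rfl⟩
  rw [← hD]
  rw [eq_div_iff (by simpa using ha1)] at hD
  refine mul_right_cancel₀ (b := Real.Gamma (a + 1) * Real.Gamma (a + b + 2 * n + 3) * (a + 1))
    (mul_ne_zero (mul_pos p3 p4).ne' ha1) ?_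
  linear_combination (lp * (n + 1)) * h1 - lr * (a + n + 2) * D * (a + 1) * h2
    - lr * (a + n + 2) * 2 ^ n * lp * Real.Gamma (a + n + 2) * Real.Gamma (a + b + n + 2) * hD

theorem moment_ratio (ha : -1 < a) (hb : -1 < b) {m : ℕ} (hm : 1 ≤ m) :
    jacobiMoment (a + 2) b (jacobiOrthonormal (a + 4) b m)
        * ((jacobiOrthonormal (a + 4) b m).coeff m * (a + m + 4))
      = jacobiMoment (a + 1) b (jacobiOrthonormal (a + 2) b (m + 1))
        * ((jacobiOrthonormal (a + 2) b (m + 1)).coeff (m + 1) * ((m + 1) * (a + 2))) := by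
  have h1 := jacobiMoment_sub_two (show 1 < a + 4 by linarith) hb hm
  have h2 := jacobiMoment_sub_one (show 0 < a + 2 by linarith) hb (show 1 ≤ m + 1 by omega)
  have hm' : (1 : ℝ) ≤ m := by exact_mod_cast hm
  have g1 := Real.Gamma_add_one (by linarith : a + m + 4 ≠ 0)
  have g2 := Real.Gamma_add_one (by linarith : a + 2 ≠ 0)
  have p1 := Real.Gamma_pos_of_pos (by linarith : 0 < a + m + 4)
  have p2 := Real.Gamma_pos_of_pos (by linarith : 0 < a + b + m + 4)
  push_cast at h2
  rw [show a + 4 - 2 = a + 2 by ring, show a + 4 + m + 1 = a + m + 4 + 1 by ring, g1,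
    show a + 4 - 1 = a + 2 + 1 by ring, g2, show a + 4 + b + m = a + b + m + 4 by ring,
    show a + 4 + b + 2 * m + 2 = a + b + 2 * m + 6 by ring] at h1
  rw [show a + 2 - 1 = a + 1 by ring, show a + 2 + ((m : ℝ) + 1) + 1 = a + m + 4 by ring,
    show a + 2 + b + ((m : ℝ) + 1) + 1 = a + b + m + 4 by ring,
    show a + 2 + b + 2 * ((m : ℝ) + 1) + 2 = a + b + 2 * m + 6 by ring] at h2
  refine mul_right_cancel₀ (b := 2 ^ (m + 2) * Real.Gamma (a + m + 4) * Real.Gamma (a + b + m + 4))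
    (by positivity) ?_
  linear_combination h1 - (m + 1) * (a + 2) * h2

theorem moment_succ_ratio (ha : -1 < a) (hb : -1 < b) {m : ℕ} (hm : 1 ≤ m) :
    jacobiMoment (a + 3) b (jacobiOrthonormal (a + 4) b m) * ((m + 1) * (a + b + m + 4))
      = jacobiMoment (a + 2) b (jacobiOrthonormal (a + 4) b m) * (2 * (a + 3)) := by
  have h1 := jacobiMoment_sub_two (show 1 < a + 4 by linarith) hb hm
  have h2 := jacobiMoment_sub_one (show 0 < a + 4 by linarith) hb hm
  have hm' : (1 : ℝ) ≤ m := by exact_mod_cast hm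
  have g1 := Real.Gamma_add_one (by linarith : a + b + m + 4 ≠ 0)
  have g2 := Real.Gamma_add_one (by linarith : a + 3 ≠ 0)
  have p1 := Real.Gamma_pos_of_pos (by linarith : 0 < a + m + 5)
  have p2 := Real.Gamma_pos_of_pos (by linarith : 0 < a + b + m + 4)
  have hl := jacobiOrthonormal_coeff_pos (show -1 < a + 4 by linarith) hb m
  rw [show a + 4 - 2 = a + 2 by ring, show a + 4 + m + 1 = a + m + 5 by ring,
    show a + 4 - 1 = a + 3 by ring, show a + 4 + b + m = a + b + m + 4 by ring] at h1
  rw [show a + 4 - 1 = a + 3 by ring, show a + 4 + m + 1 = a + m + 5 by ring,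
    show a + 4 + b + m + 1 = a + b + m + 4 + 1 by ring, g1,
    show a + 4 = a + 3 + 1 by ring, g2, show a + 3 + 1 = a + 4 by ring] at h2
  refine mul_right_cancel₀ (b := (jacobiOrthonormal (a + 4) b m).coeff m * 2 ^ (m + 1) *
    Real.Gamma (a + m + 5) * Real.Gamma (a + b + m + 4)) (by positivity) ?_
  linear_combination (m + 1) * h2 - (a + 3) * h1

/-- The one comparison in which the Gamma factors do not reduce to a rational function of `m`; they
produce the power `n ^ (2a+2)`. -/
theorem eval_one_moment_ratio (ha : -1 < a) (hb : -1 < b) (m : ℕ) :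
    (jacobiOrthonormal a b (m + 2)).eval 1 * ((jacobiOrthonormal a b (m + 2)).coeff (m + 2)
        * (2 ^ (a + b + 1) * Real.Gamma (a + 1) * Real.Gamma (a + 2) * Real.Gamma (b + m + 3)
          * (m + 2).factorial))
      = jacobiMoment (a + 1) b (jacobiOrthonormal (a + 2) b (m + 1))
        * ((jacobiOrthonormal (a + 2) b (m + 1)).coeff (m + 1)
          * (Real.Gamma (a + m + 4) * Real.Gamma (a + b + m + 4))) := by
  have h1 := jacobiOrthonormal_eval_one ha hb (show 1 ≤ m + 2 by omega)
  have h2 := jacobiMoment_sub_one (show 0 < a + 2 by linarith) hb (show 1 ≤ m + 1 by omega)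
  have h3 := jacobiOrthonormal_coeff_sq ha hb (show 1 ≤ m + 2 by omega)
  have hm' : (0 : ℝ) ≤ m := m.cast_nonneg
  have hp := jacobiOrthonormal_coeff_pos ha hb (m + 2)
  have p1 := Real.Gamma_pos_of_pos (by linarith : 0 < a + b + 2 * m + 5)
  have p2 := Real.Gamma_pos_of_pos (by linarith : 0 < a + b + 2 * m + 6)
  have p3 := Real.Gamma_pos_of_pos (by linarith : 0 < a + m + 3)
  have p4 := Real.Gamma_pos_of_pos (by linarith : 0 < a + b + m + 3)
  push_cast at h1 h2 h3
  rw [show a + b + 2 * ((m : ℝ) + 2) + 1 = a + b + 2 * m + 5 by ring,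
    show a + ((m : ℝ) + 2) + 1 = a + m + 3 by ring,
    show a + b + ((m : ℝ) + 2) + 1 = a + b + m + 3 by ring] at h1 h3
  rw [show a + b + 2 * ((m : ℝ) + 2) + 2 = a + b + 2 * m + 6 by ring,
    show b + ((m : ℝ) + 2) + 1 = b + m + 3 by ring,
    show a + b + 2 * (m : ℝ) + 5 = a + b + 1 + (2 * (m + 2) : ℕ) by push_cast; ring,
    Real.rpow_add_natCast (by norm_num),
    show a + b + 1 + (2 * (m + 2) : ℕ) = a + b + 2 * (m : ℝ) + 5 by push_cast; ring] at h3
  rw [show a + 2 - 1 = a + 1 by ring, show a + 2 + ((m : ℝ) + 1) + 1 = a + m + 4 by ring,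
    show a + 2 + b + ((m : ℝ) + 1) + 1 = a + b + m + 4 by ring,
    show a + 2 + b + 2 * ((m : ℝ) + 1) + 2 = a + b + 2 * m + 6 by ring] at h2
  refine mul_right_cancel₀ (b := Real.Gamma (a + b + 2 * m + 5) * Real.Gamma (a + b + 2 * m + 6))
    (by positivity) ?_
  rw [show 2 * (m + 2) = (m + 2) + (m + 1 + 1) by ring, pow_add] at h3
  set lp := (jacobiOrthonormal a b (m + 2)).coeff (m + 2)
  set lr := (jacobiOrthonormal (a + 2) b (m + 1)).coeff (m + 1)
  set I := jacobiMoment (a + 1) b (jacobiOrthonormal (a + 2) b (m + 1))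
  linear_combination (lp * (2 ^ (a + b + 1) * Real.Gamma (a + 2) * Real.Gamma (b + m + 3)
          * (m + 2).factorial) * Real.Gamma (a + b + 2 * m + 6)) * h1
    - (lp ^ 2 * 2 ^ (m + 2) * Real.Gamma (a + m + 3) * Real.Gamma (a + b + m + 3)
      * 2 ^ (a + b + 1) * Real.Gamma (b + m + 3) * (m + 2).factorial) * h2
    + I * lr * Real.Gamma (a + m + 4) * Real.Gamma (a + b + m + 4) * h3

theorem moment_pos (ha : -1 < a) (hb : -1 < b) (m : ℕ) :
    0 < jacobiMoment (a + 1) b (jacobiOrthonormal (a + 2) b (m + 1)) := by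
  have h := eval_one_moment_ratio ha hb m
  have hm' : (0 : ℝ) ≤ m := m.cast_nonneg
  have h1 := jacobiOrthonormal_eval_one_pos ha hb (m + 2)
  have h2 := jacobiOrthonormal_coeff_pos ha hb (m + 2)
  have h3 := jacobiOrthonormal_coeff_pos (show -1 < a + 2 by linarith) hb (m + 1)
  have p1 := Real.Gamma_pos_of_pos (by linarith : 0 < a + 1)
  have p2 := Real.Gamma_pos_of_pos (by linarith : 0 < a + 2)
  have p3 := Real.Gamma_pos_of_pos (by linarith : 0 < b + m + 3)
  have p4 := Real.Gamma_pos_of_pos (by linarith : 0 < a + m + 4)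
  have p5 := Real.Gamma_pos_of_pos (by linarith : 0 < a + b + m + 4)
  have p6 : (0 : ℝ) < (m + 2).factorial := by exact_mod_cast (m + 2).factorial_pos
  refine pos_of_mul_pos_left (b := (jacobiOrthonormal (a + 2) b (m + 1)).coeff (m + 1)
    * (Real.Gamma (a + m + 4) * Real.Gamma (a + b + m + 4))) ?_ (by positivity)
  rw [← h]
  positivity

end Ratios

theorem tendsto_natCast_add_div_natCast_add (c d : ℝ) :
    Tendsto (fun n : ℕ => ((n : ℝ) + c) / (n + d)) atTop (𝓝 1) := by
  have hd : Tendsto (fun n : ℕ => (n : ℝ) + d) atTop atTop :=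
    tendsto_atTop_add_const_right _ _ tendsto_natCast_atTop_atTop
  have h := (hd.const_div_atTop (c - d)).const_add 1
  rw [add_zero] at h
  refine h.congr' ?_
  filter_upwards [hd.eventually_gt_atTop 0] with n hn
  field_simp
  ring

/-! ### Limits of the ratios -/

section Limits

variable {a b : ℝ}

theorem tendsto_coeff_ratio (ha : -1 < a) (hb : -1 < b) :
    Tendsto (fun n : ℕ => (jacobiOrthonormal (a + 2) b n).coeff n
      / (jacobiOrthonormal a b (n + 1)).coeff (n + 1)) atTop (𝓝 1) := by
  have h := ((tendsto_natCast_add_div_natCast_add (b + 1) (a + b + 2)).mul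
    (tendsto_natCast_add_div_natCast_add 1 (a + 2))).sqrt
  rw [mul_one, Real.sqrt_one] at h
  refine h.congr' ?_
  filter_upwards [eventually_ge_atTop 1] with n hn
  have hn' : (1 : ℝ) ≤ n := by exact_mod_cast hn
  have h1 := jacobiOrthonormal_coeff_pos (show -1 < a + 2 by linarith) hb n
  have h2 := jacobiOrthonormal_coeff_pos ha hb (n + 1)
  have h3 := coeff_sq_ratio ha hb hn
  have d1 : 0 < (n : ℝ) + (a + b + 2) := by linarith
  have d2 : 0 < (n : ℝ) + (a + 2) := by linarith
  rw [Real.sqrt_eq_iff_mul_self_eq_of_pos (by positivity)]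
  field_simp
  linear_combination h3

theorem tendsto_eval_one_ratio (ha : -1 < a) (hb : -1 < b) :
    Tendsto (fun n : ℕ => (jacobiOrthonormal (a + 2) b n).eval 1
      / (derivative (jacobiOrthonormal a b (n + 1))).eval 1) atTop (𝓝 (1 / (a + 2))) := by
  have ha2 : 0 < a + 2 := by linarith
  have h := ((tendsto_coeff_ratio ha hb).mul
    (tendsto_natCast_add_div_natCast_add (a + 2) 1)).div_const (a + 2)
  rw [mul_one] at h
  refine h.congr' ?_
  filter_upwards [eventually_ge_atTop 1] with n hn
  have hn' : (1 : ℝ) ≤ n := by exact_mod_cast hn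
  have h1 := jacobiOrthonormal_eval_one_pos (show -1 < a + 2 by linarith) hb n
  have h2 := jacobiOrthonormal_coeff_pos ha hb (n + 1)
  have h3 := eval_one_ratio ha hb hn
  have h4 : (derivative (jacobiOrthonormal a b (n + 1))).eval 1 ≠ 0 := by
    intro h0
    rw [h0, zero_mul] at h3
    have : 0 < (jacobiOrthonormal (a + 2) b n).eval 1
        * ((jacobiOrthonormal a b (n + 1)).coeff (n + 1) * ((a + 2) * (n + 1))) := by positivity
    linarith
  field_simp
  linear_combination -h3

theorem tendsto_moment_ratio (ha : -1 < a) (hb : -1 < b) :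
    Tendsto (fun m : ℕ => jacobiMoment (a + 2) b (jacobiOrthonormal (a + 4) b m)
      / jacobiMoment (a + 1) b (jacobiOrthonormal (a + 2) b (m + 1))) atTop (𝓝 (a + 2)) := by
  have hc := tendsto_coeff_ratio (show -1 < a + 2 by linarith) hb
  rw [show a + 2 + 2 = a + 4 by ring] at hc
  have h := ((hc.inv₀ one_ne_zero).mul
    (tendsto_natCast_add_div_natCast_add 1 (a + 4))).mul_const (a + 2)
  rw [inv_one, one_mul, one_mul] at h
  refine h.congr' ?_
  filter_upwards [eventually_ge_atTop 1] with m hm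
  have hm' : (1 : ℝ) ≤ m := by exact_mod_cast hm
  have h1 := moment_pos ha hb m
  have h2 := jacobiOrthonormal_coeff_pos (show -1 < a + 4 by linarith) hb m
  have h3 := moment_ratio ha hb hm
  have h4 := jacobiOrthonormal_coeff_pos (show -1 < a + 2 by linarith) hb (m + 1)
  have d : 0 < (m : ℝ) + (a + 4) := by linarith
  field_simp
  linear_combination -h3

theorem tendsto_moment_succ_ratio (ha : -1 < a) (hb : -1 < b) :
    Tendsto (fun m : ℕ => jacobiMoment (a + 3) b (jacobiOrthonormal (a + 4) b m)
      / jacobiMoment (a + 2) b (jacobiOrthonormal (a + 4) b m)) atTop (𝓝 0) := by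
  have hd : ∀ d : ℝ, Tendsto (fun n : ℕ => (n : ℝ) + d) atTop atTop := fun d =>
    tendsto_atTop_add_const_right _ _ tendsto_natCast_atTop_atTop
  have h := ((hd 1).atTop_mul_atTop₀ (hd (a + b + 4))).const_div_atTop (2 * (a + 3))
  refine h.congr' ?_
  filter_upwards [eventually_ge_atTop 1,
    (tendsto_moment_ratio ha hb).eventually_ne (show a + 2 ≠ 0 by linarith)] with m hm hne
  have hm' : (1 : ℝ) ≤ m := by exact_mod_cast hm
  have h1 : jacobiMoment (a + 2) b (jacobiOrthonormal (a + 4) b m) ≠ 0 := (div_ne_zero_iff.1 hne).1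
  have h2 := moment_succ_ratio ha hb hm
  have d : 0 < (m : ℝ) + (a + b + 4) := by linarith
  rw [div_eq_div_iff (by positivity) h1]
  linear_combination -h2

theorem tendsto_eval_one_div_derivative (ha : -1 < a) (hb : -1 < b) :
    Tendsto (fun n : ℕ => (jacobiOrthonormal a b n).eval 1
      / (derivative (jacobiOrthonormal a b n)).eval 1) atTop (𝓝 0) := by
  have hd : ∀ d : ℝ, Tendsto (fun n : ℕ => (n : ℝ) + d) atTop atTop := fun d =>
    tendsto_atTop_add_const_right _ _ tendsto_natCast_atTop_atTop
  have h := ((hd 0).atTop_mul_atTop₀ (hd (a + b + 1))).const_div_atTop (2 * (a + 1))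
  refine h.congr' ?_
  filter_upwards [eventually_ge_atTop 1] with n hn
  have hn' : (1 : ℝ) ≤ n := by exact_mod_cast hn
  have h1 := jacobiOrthonormal_eval_one_pos ha hb n
  have d : 0 < n + a + b + 1 := by linarith
  have d' : 0 < a + 1 := by linarith
  rw [jacobiOrthonormal_derivative_eval_one ha hb hn, add_zero,
    show n + (a + b + 1) = n + a + b + 1 by ring]
  field_simp

/-- The limit of `p_n(1) n^(-2a-2)` relative to the moment of order `a + 1` of the Jacobi
polynomial of parameters `(a + 2, b)`. -/
theorem tendsto_eval_one_moment_ratio (ha : -1 < a) (hb : -1 < b) :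
    Tendsto (fun m : ℕ => (jacobiOrthonormal a b (m + 2)).eval 1
      / jacobiMoment (a + 1) b (jacobiOrthonormal (a + 2) b (m + 1)) / ((m : ℝ) + 2) ^ (2 * a + 2))
      atTop (𝓝 (1 / (2 ^ (a + b + 1) * Real.Gamma (a + 1) * Real.Gamma (a + 2)))) := by
  -- The Gamma quotient has order `(a + 3) + (a + b + 3) - (b + 2) - 2 = 2a + 2`; `k4` covers the
  -- factorial and `k5` replaces `m` by `m + 2` in the power.
  have k1 := tendsto_Gamma_ratio (show 0 < a + 3 by linarith)
  have k2 := tendsto_Gamma_ratio (show 0 < a + b + 3 by linarith)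
  have k3 := tendsto_Gamma_ratio (show 0 < b + 2 by linarith)
  have k4 := tendsto_Gamma_ratio (show (0 : ℝ) < 2 by norm_num)
  have k5 := (tendsto_natCast_add_div_natCast_add 0 2).rpow_const
    (p := 2 * a + 2) (Or.inl one_ne_zero)
  have k6 := (tendsto_add_atTop_iff_nat 1).2 (tendsto_coeff_ratio ha hb)
  have h := ((((k1.mul k2).div (k3.mul k4) (by norm_num)).mul k5).mul k6).div_const
    (2 ^ (a + b + 1) * Real.Gamma (a + 1) * Real.Gamma (a + 2))
  simp only [Real.one_rpow, mul_one, div_one] at h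
  refine h.congr' ?_
  filter_upwards [eventually_ge_atTop 1] with m hm
  have hm' : (1 : ℝ) ≤ m := by exact_mod_cast hm
  have hI := moment_pos ha hb m
  have h1 := eval_one_moment_ratio ha hb m
  have h2 := jacobiOrthonormal_coeff_pos ha hb (m + 2)
  have p1 := Real.Gamma_pos_of_pos (by linarith : 0 < a + 1)
  have p2 := Real.Gamma_pos_of_pos (by linarith : 0 < a + 2)
  have p3 := Real.Gamma_pos_of_pos (by linarith : 0 < b + m + 3)
  have p4 := Real.Gamma_pos_of_pos (by linarith : (0 : ℝ) < m + 3)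
  have p6 : (0 : ℝ) < m.factorial := by exact_mod_cast m.factorial_pos
  have hfac : ((m + 2).factorial : ℝ) = Real.Gamma (m + 3) := by
    rw [← Real.Gamma_nat_eq_factorial]
    push_cast
    ring_nf
  have hpow : (m : ℝ) ^ (2 * a + 2) * ((m : ℝ) ^ (b + 2) * (m : ℝ) ^ (2 : ℝ))
      = (m : ℝ) ^ (a + 3) * (m : ℝ) ^ (a + b + 3) := by
    rw [← Real.rpow_add (by linarith), ← Real.rpow_add (by linarith), ← Real.rpow_add (by linarith)]
    ring_nf
  have q1 : (0 : ℝ) < (m : ℝ) ^ (2 * a + 2) := Real.rpow_pos_of_pos (by linarith) _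
  have q2 : (0 : ℝ) < (m : ℝ) ^ (b + 2) := Real.rpow_pos_of_pos (by linarith) _
  have q3 : (0 : ℝ) < (m : ℝ) ^ (2 : ℝ) := Real.rpow_pos_of_pos (by linarith) _
  have q4 : (0 : ℝ) < (m : ℝ) ^ (a + 3) := Real.rpow_pos_of_pos (by linarith) _
  have q5 : (0 : ℝ) < (m : ℝ) ^ (a + b + 3) := Real.rpow_pos_of_pos (by linarith) _
  have q6 : (0 : ℝ) < ((m : ℝ) + 2) ^ (2 * a + 2) := Real.rpow_pos_of_pos (by linarith) _
  have q7 : (0 : ℝ) < 2 ^ (a + b + 1) := Real.rpow_pos_of_pos (by norm_num) _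
  rw [hfac] at h1
  simp only [Pi.div_apply]
  rw [add_zero, Real.div_rpow (by linarith) (by linarith),
    show a + 3 + m + 1 = a + m + 4 by ring, show a + b + 3 + m + 1 = a + b + m + 4 by ring,
    show b + 2 + m + 1 = b + m + 3 by ring, show 2 + (m : ℝ) + 1 = m + 3 by ring]
  have hu : (jacobiOrthonormal a b (m + 2)).eval 1
      / jacobiMoment (a + 1) b (jacobiOrthonormal (a + 2) b (m + 1))
      = (jacobiOrthonormal (a + 2) b (m + 1)).coeff (m + 1)
          * (Real.Gamma (a + m + 4) * Real.Gamma (a + b + m + 4))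
        / ((jacobiOrthonormal a b (m + 2)).coeff (m + 2)
        * (2 ^ (a + b + 1) * Real.Gamma (a + 1) * Real.Gamma (a + 2) * Real.Gamma (b + m + 3)
          * Real.Gamma (m + 3))) := by
    rw [div_eq_div_iff hI.ne' (by positivity)]
    linear_combination h1
  rw [hu, show m + 1 + 1 = m + 2 by ring]
  generalize (m : ℝ) ^ (2 * a + 2) = P1 at *
  generalize (m : ℝ) ^ (b + 2) = P2 at *
  generalize (m : ℝ) ^ (2 : ℝ) = P3 at *
  generalize (m : ℝ) ^ (a + 3) = P4 at *
  generalize (m : ℝ) ^ (a + b + 3) = P5 at *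
  generalize ((m : ℝ) + 2) ^ (2 * a + 2) = P6 at *
  generalize (2 : ℝ) ^ (a + b + 1) = P7 at *
  generalize Real.Gamma (a + m + 4) = G1 at *
  generalize Real.Gamma (a + b + m + 4) = G2 at *
  generalize Real.Gamma (b + m + 3) = G3 at *
  generalize Real.Gamma ((m : ℝ) + 3) = G4 at *
  field_simp
  linear_combination G1 * G2 * (jacobiOrthonormal (a + 2) b (m + 1)).coeff (m + 1) * hpow

end Limits

/-! ### The connection coefficients -/

/-- The normalization condition determines the limit of the last coefficient from the limits of
the ratios of the coefficients. -/
theorem tendsto_last_coefficient {C x y u v w : ℕ → ℝ} {x₀ y₀ : ℝ}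
    (hu : ∀ m, 0 < u m) (hv : ∀ m, 0 < v m) (hw : ∀ m, 0 < w m)
    (hpos : ∀ m, 0 < C m * x m * u m + C m * y m * v m + C m * w m)
    (hone : ∀ m, (C m * x m * u m + C m * y m * v m + C m * w m)
      * (C m * x m / u m + C m * y m / v m + C m / w m) = 1)
    (hvu : Tendsto (fun m => v m / u m) atTop (𝓝 1))
    (hwv : Tendsto (fun m => w m / v m) atTop (𝓝 1))
    (hx : Tendsto x atTop (𝓝 x₀)) (hy : Tendsto y atTop (𝓝 y₀)) (hL : 0 < x₀ + y₀ + 1) :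
    Tendsto C atTop (𝓝 (1 / (x₀ + y₀ + 1))) := by
  have hwu : Tendsto (fun m => w m / u m) atTop (𝓝 1) := by
    have h := hwv.mul hvu
    rw [mul_one] at h
    refine h.congr fun m => ?_
    have := (hv m).ne'
    field_simp
  have hF : Tendsto (fun m => x m + y m * (v m / u m) + w m / u m) atTop (𝓝 (x₀ + y₀ + 1)) := by
    simpa using (hx.add (hy.mul hvu)).add hwu
  have hG : Tendsto (fun m => x m + y m * (v m / u m)⁻¹ + (w m / u m)⁻¹) atTop
      (𝓝 (x₀ + y₀ + 1)) := by
    simpa using (hx.add (hy.mul (hvu.inv₀ one_ne_zero))).add (hwu.inv₀ one_ne_zero)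
  have hlim := ((hF.mul hG).sqrt).inv₀ (by positivity)
  rw [Real.sqrt_mul_self hL.le, ← one_div] at hlim
  refine hlim.congr' ?_
  filter_upwards [hF.eventually_const_lt hL, hG.eventually_const_lt hL] with m h1 h2
  have := hu m
  have := hv m
  have := hw m
  -- The normalization gives only `C ^ 2`; the sign comes from the positive leading coefficient of
  -- `q`.
  have h3 : 0 < C m := by
    have h := hpos m
    rw [show C m * x m * u m + C m * y m * v m + C m * w m
      = C m * ((x m + y m * (v m / u m) + w m / u m) * u m) by field_simp] at h
    exact pos_of_mul_pos_left h (by positivity)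
  have h4 : C m ^ 2 * ((x m + y m * (v m / u m) + w m / u m)
      * (x m + y m * (v m / u m)⁻¹ + (w m / u m)⁻¹)) = 1 := by
    rw [← hone m]
    field_simp
  rw [inv_eq_iff_eq_inv, Real.sqrt_eq_iff_mul_self_eq_of_pos (by positivity), ← mul_inv, ← sq]
  exact inv_eq_of_mul_eq_one_right h4

/-- The orthogonality conditions determine the ratios of the coefficients. -/
theorem coefficient_ratios {M N A B C p p' r I I₂ J : ℝ} (hM : 0 ≤ M) (hN : 0 < N)
    (hp' : 0 < p') (hp : 0 < p) (hr : 0 < r) (hI : 0 < I)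
    (h1 : M * (A * p) = B * I - C * I₂) (h2 : N * (A * p' + B * r) = C * J) :
    B = C * ((I₂ / I + M / N * (J / I * (p / p'))) / (1 + M * (p / I * (r / p')))) ∧
      A = C * (J / I * (p / p') / N * (p / I)⁻¹
        - (I₂ / I + M / N * (J / I * (p / p'))) / (1 + M * (p / I * (r / p'))) * (r / p')) := by
  have hd : 0 < 1 + M * (p / I * (r / p')) := by positivity
  -- The second relation is solved for `A` and put into the first. The results are grouped into the
  -- ratios whose limits are known.
  have hA : A = C * J / (N * p') - B * (r / p') := by
    field_simp
    linear_combination h2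
  have hB : B = C * ((I₂ / I + M / N * (J / I * (p / p'))) / (1 + M * (p / I * (r / p')))) := by
    rw [mul_div_assoc', eq_div_iff hd.ne']
    rw [hA] at h1
    field_simp at h1 ⊢
    linear_combination -h1
  refine ⟨hB, ?_⟩
  rw [mul_sub, ← mul_assoc C (_ / (1 + _)), ← hB, hA]
  congr 1
  field_simp

/-- In the application `t = α + 2` and `w = n ^ (2α+2)`; `p, p', r` are values at 1, `I, I₂, J`
moments and `u, v, s` leading coefficients. The sequences `y` and `x` in the proof are `B / C` and
`A / C`. The denominator of `y` grows like `M c w / t` if `M > 0` and is 1 if `M = 0`; this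
separates the two cases. -/
theorem tendsto_coefficients {M N t c : ℝ} {A B C p p' r I I₂ J u v s w : ℕ → ℝ}
    (hM : 0 ≤ M) (hN : 0 < N) (ht : 0 < t) (hc : 0 < c)
    (hp : ∀ m, 0 < p m) (hp' : ∀ m, 0 < p' m) (hr : ∀ m, 0 < r m) (hI : ∀ m, 0 < I m)
    (hu : ∀ m, 0 < u m) (hv : ∀ m, 0 < v m) (hs : ∀ m, 0 < s m)
    (h1 : ∀ m, M * (A m * p m) = B m * I m - C m * I₂ m)
    (h2 : ∀ m, N * (A m * p' m + B m * r m) = C m * J m)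
    (hpos : ∀ m, 0 < A m * u m + B m * v m + C m * s m)
    (hone : ∀ m, (A m * u m + B m * v m + C m * s m) * (A m / u m + B m / v m + C m / s m) = 1)
    (hvu : Tendsto (fun m => v m / u m) atTop (𝓝 1))
    (hsv : Tendsto (fun m => s m / v m) atTop (𝓝 1))
    (hrp : Tendsto (fun m => r m / p' m) atTop (𝓝 (1 / t)))
    (hII : Tendsto (fun m => I₂ m / I m) atTop (𝓝 t))
    (hJI : Tendsto (fun m => J m / I m) atTop (𝓝 0))
    (hpp : Tendsto (fun m => p m / p' m) atTop (𝓝 0))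
    (hpI : Tendsto (fun m => p m / I m / w m) atTop (𝓝 c))
    (hw : Tendsto w atTop atTop) :
    (0 < M → Tendsto (fun m => A m * w m) atTop (𝓝 (-(t / (M * c)))) ∧
      Tendsto (fun m => B m * w m) atTop (𝓝 (t ^ 2 / (M * c))) ∧ Tendsto C atTop (𝓝 1)) ∧
    (M = 0 → Tendsto A atTop (𝓝 (-1 / t)) ∧ Tendsto B atTop (𝓝 1) ∧
      Tendsto C atTop (𝓝 (1 / t))) := by
  set y : ℕ → ℝ := fun m => (I₂ m / I m + M / N * (J m / I m * (p m / p' m)))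
    / (1 + M * (p m / I m * (r m / p' m))) with hy
  set x : ℕ → ℝ := fun m => J m / I m * (p m / p' m) / N * (p m / I m)⁻¹ - y m * (r m / p' m) with hx
  have hB : ∀ m, B m = C m * y m := fun m =>
    (coefficient_ratios hM hN (hp' m) (hp m) (hr m) (hI m) (h1 m) (h2 m)).1
  have hA : ∀ m, A m = C m * x m := fun m =>
    (coefficient_ratios hM hN (hp' m) (hp m) (hr m) (hI m) (h1 m) (h2 m)).2
  have hw0 : ∀ᶠ m in atTop, 0 < w m := hw.eventually_gt_atTop 0
  have hwi : Tendsto (fun m => (w m)⁻¹) atTop (𝓝 0) := hw.inv_tendsto_atTop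
  have hJp := hJI.mul hpp
  rw [zero_mul] at hJp
  have hnum : Tendsto (fun m => I₂ m / I m + M / N * (J m / I m * (p m / p' m))) atTop (𝓝 t) := by
    simpa using hII.add (hJp.const_mul (M / N))
  -- the first term of `x`, multiplied by `w`
  have hxw : Tendsto (fun m => J m / I m * (p m / p' m) / N * (p m / I m)⁻¹ * w m) atTop (𝓝 0) := by
    have h := (hJp.div_const N).mul (hpI.inv₀ hc.ne')
    rw [zero_div, zero_mul] at h
    refine h.congr' ?_
    filter_upwards [hw0] with m hm
    rw [inv_div, inv_div]
    have := (hp m).ne'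
    field_simp
  have hx0 : Tendsto (fun m => J m / I m * (p m / p' m) / N * (p m / I m)⁻¹) atTop (𝓝 0) := by
    have h := hxw.mul hwi
    rw [zero_mul] at h
    refine h.congr' ?_
    filter_upwards [hw0] with m hm
    field_simp
  have hC : ∀ {x₀ y₀ : ℝ}, Tendsto x atTop (𝓝 x₀) → Tendsto y atTop (𝓝 y₀) → 0 < x₀ + y₀ + 1 →
      Tendsto C atTop (𝓝 (1 / (x₀ + y₀ + 1))) := by
    intro x₀ y₀ hx1 hy1 hL
    simp only [hA, hB] at hpos hone
    exact tendsto_last_coefficient hu hv hs hpos hone hvu hsv hx1 hy1 hL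
  constructor
  · intro hM'
    have hden : Tendsto (fun m => (1 + M * (p m / I m * (r m / p' m))) * (w m)⁻¹) atTop
        (𝓝 (M * c / t)) := by
      have h := hwi.add ((hpI.mul hrp).const_mul M)
      rw [zero_add, show M * (c * (1 / t)) = M * c / t by ring] at h
      refine h.congr fun m => ?_
      ring
    have hyw : Tendsto (fun m => y m * w m) atTop (𝓝 (t ^ 2 / (M * c))) := by
      have h := hnum.div hden (by positivity)
      rw [show t / (M * c / t) = t ^ 2 / (M * c) by field_simp] at h
      refine h.congr' ?_
      filter_upwards [hw0] with m hm
      have := hp m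
      have := hp' m
      have := hr m
      have := hI m
      have hd : 0 < 1 + M * (p m / I m * (r m / p' m)) := by positivity
      simp only [hy, Pi.div_apply]
      generalize 1 + M * (p m / I m * (r m / p' m)) = d at hd
      generalize I₂ m / I m + M / N * (J m / I m * (p m / p' m)) = e
      field_simp
    have hxw' : Tendsto (fun m => x m * w m) atTop (𝓝 (-(t / (M * c)))) := by
      have h := hxw.sub (hyw.mul hrp)
      rw [show 0 - t ^ 2 / (M * c) * (1 / t) = -(t / (M * c)) by field_simp; ring] at h
      refine h.congr fun m => ?_
      simp only [hx]
      ring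
    have hto0 : ∀ {z : ℕ → ℝ} {l : ℝ}, Tendsto (fun m => z m * w m) atTop (𝓝 l) →
        Tendsto z atTop (𝓝 0) := by
      intro z l hz
      have h := hz.mul hwi
      rw [mul_zero] at h
      refine h.congr' ?_
      filter_upwards [hw0] with m hm
      field_simp
    have hC1 : Tendsto C atTop (𝓝 1) := by
      simpa using hC (hto0 hxw') (hto0 hyw) (by norm_num)
    refine ⟨?_, ?_, hC1⟩
    · simpa only [one_mul, hA, mul_assoc] using hC1.mul hxw'
    · simpa only [one_mul, hB, mul_assoc] using hC1.mul hyw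
  · rintro rfl
    have hy1 : Tendsto y atTop (𝓝 t) := by
      simpa [hy] using hII
    have hx1 : Tendsto x atTop (𝓝 (-1)) := by
      have h := hx0.sub (hy1.mul hrp)
      rwa [show 0 - t * (1 / t) = -1 by field_simp; ring] at h
    have hC1 := hC hx1 hy1 (by linarith)
    rw [show -1 + t + 1 = t by ring] at hC1
    refine ⟨?_, ?_, hC1⟩
    · have h := hC1.mul hx1
      rw [show 1 / t * -1 = -1 / t by ring] at h
      exact h.congr fun m => (hA m).symm
    · have h := hC1.mul hy1
      rw [show 1 / t * t = 1 by field_simp] at h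
      exact h.congr fun m => (hB m).symm

/-- The limits of the connection coefficients, with the index shifted by two. -/
theorem jacobiSobolev_coefficient_limits {α β M N : ℝ} (hα : -1 < α) (hβ : -1 < β) (hM : 0 ≤ M)
    (hN : 0 < N) {A B K : ℕ → ℝ}
    (h : ∀ m, jacobiSobolevOrthonormal α β M N (m + 2) =
      C (A m) * jacobiOrthonormal α β (m + 2)
      + C (B m) * (X - 1) * jacobiOrthonormal (α + 2) β (m + 1)
      + C (K m) * (X - 1) ^ 2 * jacobiOrthonormal (α + 4) β m) :
    (0 < M → ∃ c : ℝ, 0 < c ∧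
      Tendsto (fun m => A m * ((m : ℝ) + 2) ^ (2 * α + 2)) atTop (𝓝 (-((α + 2) / (M * c)))) ∧
      Tendsto (fun m => B m * ((m : ℝ) + 2) ^ (2 * α + 2)) atTop (𝓝 ((α + 2) ^ 2 / (M * c))) ∧
      Tendsto K atTop (𝓝 1)) ∧
    (M = 0 → Tendsto A atTop (𝓝 (-1 / (α + 2))) ∧ Tendsto B atTop (𝓝 1) ∧
      Tendsto K atTop (𝓝 (1 / (α + 2)))) := by
  have hα2 : -1 < α + 2 := by linarith
  have hα4 : -1 < α + 4 := by linarith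
  have hrel := fun m => jacobiSobolev_relations hα hβ hM hN.le (h m)
  have hp := fun m => jacobiOrthonormal_eval_one_pos hα hβ (m + 2)
  have hr := fun m => jacobiOrthonormal_eval_one_pos hα2 hβ (m + 1)
  have hp' : ∀ m : ℕ, 0 < (derivative (jacobiOrthonormal α β (m + 2))).eval 1 := by
    intro m
    have h1 := hp m
    rw [jacobiOrthonormal_derivative_eval_one hα hβ (by omega)]
    have : (0 : ℝ) ≤ m := m.cast_nonneg
    have : 0 < (m + 2 : ℕ) + α + β + 1 := by push_cast; linarith
    have : 0 < α + 1 := by linarith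
    positivity
  have hsv := tendsto_coeff_ratio hα2 hβ
  rw [show α + 2 + 2 = α + 4 by ring] at hsv
  -- `J / I = (J / I₂) * (I₂ / I)`, a null sequence times a convergent one.
  have hJI := (tendsto_moment_succ_ratio hα hβ).mul (tendsto_moment_ratio hα hβ)
  rw [zero_mul] at hJI
  have hJI' : Tendsto (fun m => jacobiMoment (α + 3) β (jacobiOrthonormal (α + 4) β m)
      / jacobiMoment (α + 1) β (jacobiOrthonormal (α + 2) β (m + 1))) atTop (𝓝 0) := by
    refine hJI.congr' ?_
    filter_upwards [(tendsto_moment_ratio hα hβ).eventually_ne (show α + 2 ≠ 0 by linarith)]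
      with m hm
    exact div_mul_div_cancel₀ (div_ne_zero_iff.1 hm).1
  have hw : Tendsto (fun m : ℕ => ((m : ℝ) + 2) ^ (2 * α + 2)) atTop atTop :=
    (tendsto_rpow_atTop (by linarith)).comp
      (tendsto_atTop_add_const_right _ _ tendsto_natCast_atTop_atTop)
  have p1 := Real.Gamma_pos_of_pos (by linarith : 0 < α + 1)
  have p2 := Real.Gamma_pos_of_pos (by linarith : 0 < α + 2)
  have hc : 0 < 1 / (2 ^ (α + β + 1) * Real.Gamma (α + 1) * Real.Gamma (α + 2)) := by positivity
  obtain ⟨h1, h2⟩ := tendsto_coefficients hM hN (by linarith : 0 < α + 2) hc hp hp' hr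
    (fun m => moment_pos hα hβ m)
    (fun m => jacobiOrthonormal_coeff_pos hα hβ (m + 2))
    (fun m => jacobiOrthonormal_coeff_pos hα2 hβ (m + 1))
    (fun m => jacobiOrthonormal_coeff_pos hα4 hβ m)
    (fun m => (hrel m).1) (fun m => (hrel m).2.1) (fun m => (hrel m).2.2.1)
    (fun m => (hrel m).2.2.2)
    ((tendsto_add_atTop_iff_nat 1).2 (tendsto_coeff_ratio hα hβ)) hsv
    ((tendsto_add_atTop_iff_nat 1).2 (tendsto_eval_one_ratio hα hβ))
    (tendsto_moment_ratio hα hβ) hJI'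
    ((tendsto_add_atTop_iff_nat 2).2 (tendsto_eval_one_div_derivative hα hβ))
    (tendsto_eval_one_moment_ratio hα hβ) hw
  exact ⟨fun hM' => ⟨_, hc, h1 hM'⟩, h2⟩

theorem asympEq_of_tendsto_shift {z w : ℕ → ℝ} {v : ℕ → ℝ} {l : ℝ} (hl : l ≠ 0)
    (h : Tendsto (fun m => z (m + 2) * v m) atTop (𝓝 l)) (hw : ∀ m, w (m + 2) = l / v m) :
    AsympEq z w := by
  refine (tendsto_add_atTop_iff_nat 2).1 ?_
  have h' := h.div_const l
  rw [div_self hl] at h'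
  refine h'.congr fun m => ?_
  rw [hw, div_div_eq_mul_div]

theorem theorem1 (α β M N : ℝ) (hα : -1 < α) (hβ : -1 < β) (hM : 0 ≤ M) (hN : 0 ≤ N) :
    ∃ A B C : ℕ → ℝ,
      (∀ n : ℕ, 2 ≤ n → ∀ a b c : ℝ,
        jacobiSobolevOrthonormal α β M N n =
            Polynomial.C a * jacobiOrthonormal α β n
              + Polynomial.C b * (X - 1) * jacobiOrthonormal (α + 2) β (n - 1)
              + Polynomial.C c * (X - 1) ^ 2 * jacobiOrthonormal (α + 4) β (n - 2)
          ↔ a = A n ∧ b = B n ∧ c = C n) ∧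
      (0 < M * N →
        (∃ C₁ : ℝ, 0 < C₁ ∧ AsympEq A (fun n => -C₁ * (n : ℝ) ^ (-2 * α - 2))) ∧
        (∃ C₂ : ℝ, 0 < C₂ ∧ AsympEq B (fun n => C₂ * (n : ℝ) ^ (-2 * α - 2))) ∧
        AsympEq C (fun _ => 1)) ∧
      (M = 0 → 0 < N →
        AsympEq A (fun _ => -1 / (α + 2)) ∧
        AsympEq B (fun _ => 1) ∧
        AsympEq C (fun _ => 1 / (α + 2))) := by
  have hα2 : 0 < α + 2 := by linarith
  choose A B K h using exists_jacobiSobolev_expansion hα hβ hM hN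
  have hpow : ∀ m : ℕ, ((m + 2 : ℕ) : ℝ) ^ (-2 * α - 2) = (((m : ℝ) + 2) ^ (2 * α + 2))⁻¹ := by
    intro m
    rw [← Real.rpow_neg (by positivity)]
    push_cast
    ring_nf
  -- Truncated subtraction gives arbitrary values for `n < 2`, which affect neither the expansion
  -- nor the limits.
  refine ⟨fun n => A (n - 2), fun n => B (n - 2), fun n => K (n - 2), ?_, ?_, ?_⟩
  · intro n hn a b c
    obtain ⟨m, rfl⟩ := Nat.exists_eq_add_of_le' hn
    simp only [show m + 2 - 1 = m + 1 by omega, Nat.add_sub_cancel]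
    constructor
    · intro h'
      exact jacobi_expansion_unique hα hβ m (h'.symm.trans (h m))
    · rintro ⟨rfl, rfl, rfl⟩
      exact h m
  · intro hMN
    have hM' : 0 < M := pos_of_mul_pos_left hMN hN
    have hN' : 0 < N := pos_of_mul_pos_right hMN hM
    obtain ⟨c, hc, hA, hB, hK⟩ := (jacobiSobolev_coefficient_limits hα hβ hM hN' h).1 hM'
    refine ⟨⟨(α + 2) / (M * c), by positivity, ?_⟩, ⟨(α + 2) ^ 2 / (M * c), by positivity, ?_⟩, ?_⟩
    · refine asympEq_of_tendsto_shift (neg_ne_zero.2 (by positivity)) hA fun m => ?_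
      rw [hpow]
      rfl
    · refine asympEq_of_tendsto_shift (by positivity) hB fun m => ?_
      rw [hpow]
      rfl
    · refine asympEq_of_tendsto_shift (v := fun _ => 1) one_ne_zero ?_ fun m => (div_one _).symm
      simpa using hK
  · intro hM0 hN'
    obtain ⟨hA, hB, hK⟩ := (jacobiSobolev_coefficient_limits hα hβ hM hN' h).2 hM0
    refine ⟨?_, ?_, ?_⟩
    · refine asympEq_of_tendsto_shift (v := fun _ => 1)
        (div_ne_zero (by norm_num) hα2.ne') ?_ fun m => (div_one _).symm
      simpa using hA
    · refine asympEq_of_tendsto_shift (v := fun _ => 1) one_ne_zero ?_ fun m => (div_one _).symm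
      simpa using hB
    · refine asympEq_of_tendsto_shift (v := fun _ => 1) (by positivity) ?_
        fun m => (div_one _).symm
      simpa using hK
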